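/- Let $K$ be a commutative ring that is both a $\mathbb{Q}$-algebra and an integral domain, and let $E$ be a free $K$-module with a finite basis. Identify $S_d$ with the group of permutations of $\{1,2,\dots\}$ fixing every $n>d$, and let $\omega$ be the endomorphism $\omega(\sigma)(1)=1$, $\omega(\sigma)(d)=\sigma(d-1)+1$ of the finitary symmetric group $S_\infty$. Let $\chi=(\chi_d\colon W_d\to U(K))_{d\ge1}$ be an $\omega$-invariant sequence of linear characters, that is, $W_d\le S_d$ is a subgroup, $W_d\le W_{d+1}$, $\omega(W_d)\le W_{d+1}$ and $\chi_{d+1}|_{W_d}=\chi_d=\chi_{d+1}\circ\omega|_{W_d}$ for all $d\geq 1$; let $W_0$ be the trivial group. For a $K$-module $F$ let $[\chi]^d(F)$, $d\ge 1$, be the quotient of the tensor power $T^d(F)$ by the submodule generated by all $\chi_d(\sigma)^{-1}z-\sigma z$ ($\sigma\in W_d$, $z\in T^d(F)$), where $\sigma(x_1\otimes\dots\otimes x_d)=x_{\sigma^{-1}(1)}\otimes\dots\otimes x_{\sigma^{-1}(d)}$; let $[\chi]^0(F)=K$. Write $x_1\chi\dots\chi x_d$ for the class of $x_1\otimes\dots\otimes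 x_d$. The graded $K$-module $[\chi](F)=\bigoplus_{d\ge0}[\chi]^d(F)$ is a graded associative unital $K$-algebra (the semi-symmetric algebra of weight $\chi$) with the multiplication induced by that of the tensor algebra, $(x_1\chi\dots\chi x_p)(y_1\chi\dots\chi y_q)=x_1\chi\dots\chi x_p\chi y_1\chi\dots\chi y_q$. For $p+q=n$ let $M(\chi;n;p,q)$ be the set of those $\rho\in W_n$ for which the word $(\rho(1),\dots,\rho(n))$ is lexicographically minimal in the left coset $\rho\,(W_p\times\omega^p(W_q))$. (i) There is a $K$-linear map $c_E\colon[\chi](E)\to[\chi](E)\otimes_K[\chi](E)$ such that for all $n\ge0$ and $x_1,\dots,x_n\in E$ $$c_E(x_1\chi\dots\chi x_n)=\sum_{p+q=n}\ \sum_{\rho\in M(\chi;n;p,q)}\chi_n(\rho)\,(x_{\rho(1)}\chi\dots\chi x_{\rho(p)})\otimes(x_{\rho(p+1)}\chi\dots\chi x_{\rho(n)}).$$ (It is unique, since the elements $x_1\chi\dots\chi x_n$ span.) It maps $[\chi]^n(E)$ into $\bigoplus_{p+q=n}[\chi]^p(E)\otimes[\chi]^q(E)$, and it makes $[\chi](E)$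 a graded coassociative counital $K$-coalgebra, with counit the linear form $\epsilon_E$ that is the identity on $[\chi]^0(E)=K$ and zero on $[\chi]^d(E)$ for $d>0$. (ii) Let $([\chi](E))^{*gr}=\bigoplus_{d\ge0}([\chi]^d(E))^*$, where a linear form on $[\chi]^d(E)$ is extended by zero to $[\chi](E)$. The product $f*g=m_K\circ(f\otimes g)\circ c_E$ (where $m_K\colon K\otimes_K K\to K$ is the multiplication) and the unit $\epsilon_E$ make $([\chi](E))^{*gr}$ a graded associative unital $K$-algebra. There is an isomorphism of graded unital $K$-algebras $$\iota\colon[\chi](E^*)\to([\chi](E))^{*gr}$$ from the semi-symmetric algebra of weight $\chi$ of the dual module $E^*$ onto it, given by $\iota(x_1^*\chi\dots\chi x_s^*)(x_1\chi\dots\chi x_r)=0$ if $r\ne s$, and $$\iota(x_1^*\chi\dots\chi x_r^*)(x_1\chi\dots\chi x_r)=\sum_{\sigma\in W_r}\chi_r(\sigma)\prod_{j=1}^r x_j^*(x_{\sigma^{-1}(j)})$$ (which is $1$ for $r=0$). In other words, after the identification of $([\chi](E))^{*gr}$ with $[\chi](E^*)$ via $\iota$, the algebra structure on $([\chi](E))^{*gr}$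 induced by transposition from $([\chi](E),c_E,\epsilon_E)$ is the semi-symmetric algebra structure of $[\chi](E^*)$. -/

import Mathlib

open scoped TensorProduct DirectSum

namespace SemiSym

/-- The order embedding `i ↦ k + i` of `{0, …, p - 1}` into `{0, …, n - 1}`, where `k + p ≤ n`. -/
def shiftEmb {k p n : ℕ} (h : k + p ≤ n) : Fin p ↪ Fin n where
  toFun i := ⟨k + i, by omega⟩
  inj' i j hij := by
    simp only [Fin.mk.injEq] at hij
    exact Fin.ext (by omega)

@[simp] theorem shiftEmb_val {k p n : ℕ} (h : k + p ≤ n) (i : Fin p) :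
    (shiftEmb h i : ℕ) = k + i := rfl

/-- The permutation of `Fin n` that acts on `k, …, k + p - 1` as `σ` acts on `Fin p` and fixes all
other points. For `k = 0` it is the image of `σ` under the inclusion `S_p ≤ S_n`, and for general
`k` it is the image of `ω ^ k (σ)` in `S_n`, where `ω (σ) (1) = 1` and
`ω (σ) (d) = σ (d - 1) + 1` in one-based numbering. -/
noncomputable def shiftPerm {k p n : ℕ} (h : k + p ≤ n) :
    Equiv.Perm (Fin p) →* Equiv.Perm (Fin n) :=
  Equiv.Perm.viaEmbeddingHom (shiftEmb h)

/-- An `ω`-invariant sequence of linear `K`-valued characters `χ_d : W_d → U(K)` of permutation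
groups `W_d ≤ S_d`: the groups satisfy `W_d ≤ W_{d+1}` and `ω (W_d) ≤ W_{d+1}`, and
`χ_{d+1}` restricted to `W_d` and `χ_{d+1} ∘ ω` restricted to `W_d` are both equal to `χ_d`.
(The index `d = 0`, where `S_0` is trivial, carries no information.) -/
structure OmegaInvariant (K : Type*) [CommRing K] where
  /-- the permutation groups `W_d` -/
  W : ∀ d : ℕ, Subgroup (Equiv.Perm (Fin d))
  /-- the characters `χ_d` -/
  char : ∀ d : ℕ, W d →* Kˣ
  incl_mem : ∀ (d : ℕ) (σ : W d),
    shiftPerm (k := 0) (p := d) (n := d + 1) (by omega) σ ∈ W (d + 1)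
  omega_mem : ∀ (d : ℕ) (σ : W d),
    shiftPerm (k := 1) (p := d) (n := d + 1) (by omega) σ ∈ W (d + 1)
  char_incl : ∀ (d : ℕ) (σ : W d), char (d + 1) ⟨_, incl_mem d σ⟩ = char d σ
  char_omega : ∀ (d : ℕ) (σ : W d), char (d + 1) ⟨_, omega_mem d σ⟩ = char d σ

theorem shiftPerm_apply {k p n : ℕ} (h : k + p ≤ n) (σ : Equiv.Perm (Fin p)) (i : Fin p) :
    shiftPerm h σ (shiftEmb h i) = shiftEmb h (σ i) :=
  Equiv.Perm.viaEmbedding_apply _ _ _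

theorem shiftPerm_apply_of_notMem {k p n : ℕ} (h : k + p ≤ n) (σ : Equiv.Perm (Fin p)) (i : Fin n)
    (hi : ∀ j, shiftEmb h j ≠ i) : shiftPerm h σ i = i :=
  Equiv.Perm.viaEmbedding_apply_of_notMem _ _ _ (by rintro ⟨j, hj⟩; exact hi j hj)

theorem shiftPerm_shiftPerm {k l m p n r : ℕ} (h : k + p ≤ n) (h' : l + n ≤ r) (h'' : m + p ≤ r)
    (hm : m = l + k) (σ : Equiv.Perm (Fin p)) :
    shiftPerm h' (shiftPerm h σ) = shiftPerm h'' σ := by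
  have key : ∀ j, shiftEmb h' (shiftEmb h j) = shiftEmb h'' j := fun j =>
    Fin.ext (by simp only [shiftEmb_val]; omega)
  ext1 i
  by_cases hi : ∃ j, shiftEmb h' j = i
  · obtain ⟨j, rfl⟩ := hi
    rw [shiftPerm_apply]
    by_cases hj : ∃ t, shiftEmb h t = j
    · obtain ⟨t, rfl⟩ := hj
      rw [shiftPerm_apply, key, key, shiftPerm_apply]
    · push Not at hj
      rw [shiftPerm_apply_of_notMem h σ j hj, shiftPerm_apply_of_notMem]
      intro t ht
      rw [← key] at ht
      exact hj t ((shiftEmb h').injective ht)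
  · push Not at hi
    rw [shiftPerm_apply_of_notMem h' _ i hi, shiftPerm_apply_of_notMem]
    intro t ht
    rw [← key] at ht
    exact hi _ ht

theorem shiftPerm_self {p : ℕ} (h : 0 + p ≤ p) (σ : Equiv.Perm (Fin p)) : shiftPerm h σ = σ := by
  ext1 i
  have key : ∀ j, shiftEmb h j = j := fun j => Fin.ext (by simp)
  have := shiftPerm_apply h σ i
  rwa [key, key] at this

variable {K : Type*} [CommRing K] (χ : OmegaInvariant K)

theorem OmegaInvariant.char_shift (n : ℕ) : ∀ (k p : ℕ) (h : k + p ≤ n) (σ : χ.W p),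
    ∃ hm : shiftPerm h σ ∈ χ.W n, χ.char n ⟨_, hm⟩ = χ.char p σ := by
  induction n with
  | zero =>
    intro k p h σ
    obtain rfl : k = 0 := by omega
    obtain rfl : p = 0 := by omega
    have e : shiftPerm h (σ : Equiv.Perm (Fin 0)) = σ := shiftPerm_self h _
    exact ⟨e.symm ▸ σ.2, congrArg _ (Subtype.ext e)⟩
  | succ n ih =>
    intro k p h σ
    rcases k with _ | k
    · by_cases hp : p = n + 1
      · subst hp
        have e : shiftPerm h (σ : Equiv.Perm (Fin (n + 1))) = σ := shiftPerm_self h _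
        exact ⟨e.symm ▸ σ.2, congrArg _ (Subtype.ext e)⟩
      · obtain ⟨h1, h2⟩ := ih 0 p (by omega) σ
        have e := shiftPerm_shiftPerm (k := 0) (l := 0) (p := p) (n := n) (r := n + 1)
          (by omega) (by omega) h rfl (σ : Equiv.Perm (Fin p))
        refine ⟨e ▸ χ.incl_mem n ⟨_, h1⟩, ?_⟩
        rw [← h2, ← χ.char_incl n ⟨_, h1⟩]
        exact congrArg (χ.char (n + 1)) (Subtype.ext e.symm)
    · obtain ⟨h1, h2⟩ := ih k p (by omega) σ
      have e := shiftPerm_shiftPerm (k := k) (l := 1) (p := p) (n := n) (r := n + 1)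
        (by omega) (by omega) h (by omega) (σ : Equiv.Perm (Fin p))
      refine ⟨e ▸ χ.omega_mem n ⟨_, h1⟩, ?_⟩
      rw [← h2, ← χ.char_omega n ⟨_, h1⟩]
      exact congrArg (χ.char (n + 1)) (Subtype.ext e.symm)

section Power

variable (E : Type*) [AddCommGroup E] [Module K E]

/-- The submodule of `T^d(E)` generated by all differences `χ_d(σ)⁻¹ z - σ z`, `σ ∈ W_d`, where
`σ` acts on the tensor power by `σ (x_1 ⊗ … ⊗ x_d) = x_{σ⁻¹(1)} ⊗ … ⊗ x_{σ⁻¹(d)}`. -/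
def relSub (d : ℕ) : Submodule K (⨂[K]^d E) :=
  Submodule.span K {w | ∃ (σ : χ.W d) (z : ⨂[K]^d E),
    w = (((χ.char d σ)⁻¹ : Kˣ) : K) • z
      - PiTensorProduct.reindex K (fun _ => E) (σ : Equiv.Perm (Fin d)) z}

/-- The `d`-th semi-symmetric power `[χ]^d(E)` of weight `χ`. -/
abbrev Power (d : ℕ) : Type _ := (⨂[K]^d E) ⧸ relSub χ E d

/-- The semi-symmetric algebra `[χ](E)`, the direct sum of all `[χ]^d(E)`, `d ≥ 0`. -/
abbrev SemiSymAlg : Type _ := ⨁ d : ℕ, Power χ E d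

variable {E}

theorem gMul_mem_left {p q : ℕ} (a : ⨂[K]^p E) (b : ⨂[K]^q E) (ha : a ∈ relSub χ E p) :
    DirectSum.gMulLHom K (fun i => ⨂[K]^i E) a b ∈ relSub χ E (p + q) := by
  induction ha using Submodule.span_induction with
  | mem w hw =>
    obtain ⟨σ, z, rfl⟩ := hw
    obtain ⟨hm, hc⟩ := χ.char_shift (p + q) 0 p (by omega) σ
    refine Submodule.subset_span ⟨⟨_, hm⟩, DirectSum.gMulLHom K (fun i => ⨂[K]^i E) z b, ?_⟩
    rw [hc, map_sub, map_smul, LinearMap.sub_apply, LinearMap.smul_apply]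
    congr 1
    let L : ⨂[K]^p E →ₗ[K] ⨂[K]^q E →ₗ[K] ⨂[K]^(p + q) E :=
      (DirectSum.gMulLHom K (fun i => ⨂[K]^i E)).comp
        (PiTensorProduct.reindex K (fun _ => E) (σ : Equiv.Perm (Fin p))).toLinearMap
    let R : ⨂[K]^p E →ₗ[K] ⨂[K]^q E →ₗ[K] ⨂[K]^(p + q) E :=
      (DirectSum.gMulLHom K (fun i => ⨂[K]^i E)).compr₂
        (PiTensorProduct.reindex K (fun _ => E)
          (shiftPerm (k := 0) (p := p) (n := p + q) (by omega) σ)).toLinearMap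
    suffices h : L = R from LinearMap.congr_fun (LinearMap.congr_fun h z) b
    refine PiTensorProduct.ext (MultilinearMap.ext fun x =>
      PiTensorProduct.ext (MultilinearMap.ext fun y => ?_))
    change GradedMonoid.GMul.mul (A := fun i => ⨂[K]^i E) (PiTensorProduct.reindex K (fun _ => E) _ (PiTensorProduct.tprod K x))
        (PiTensorProduct.tprod K y) = PiTensorProduct.reindex K (fun _ => E) _
        (GradedMonoid.GMul.mul (A := fun i => ⨂[K]^i E) (PiTensorProduct.tprod K x) (PiTensorProduct.tprod K y))
    rw [PiTensorProduct.reindex_tprod, TensorPower.tprod_mul_tprod, TensorPower.tprod_mul_tprod,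
      PiTensorProduct.reindex_tprod]
    congr 1
    funext i
    rw [← Equiv.apply_symm_apply (shiftPerm (k := 0) (p := p) (n := p + q) (by omega)
      (σ : Equiv.Perm (Fin p))) i, Equiv.symm_apply_apply]
    generalize (Equiv.symm _ i) = j
    refine Fin.addCases (fun j => ?_) (fun j => ?_) j
    · have e : ∀ j, Fin.castAdd q j = shiftEmb (k := 0) (p := p) (n := p + q) (by omega) j :=
        fun j => Fin.ext (by simp)
      rw [e, shiftPerm_apply, ← e, ← e, Fin.append_left, Fin.append_left,
        Equiv.symm_apply_apply]
    · rw [shiftPerm_apply_of_notMem, Fin.append_right, Fin.append_right]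
      intro t ht
      have := congrArg Fin.val ht
      simp at this
      omega
  | zero => simp
  | add x y _ _ hx hy => rw [map_add, LinearMap.add_apply]; exact add_mem hx hy
  | smul c x _ hx => rw [map_smul, LinearMap.smul_apply]; exact Submodule.smul_mem _ c hx

theorem gMul_mem_right {p q : ℕ} (a : ⨂[K]^p E) (b : ⨂[K]^q E) (hb : b ∈ relSub χ E q) :
    DirectSum.gMulLHom K (fun i => ⨂[K]^i E) a b ∈ relSub χ E (p + q) := by
  induction hb using Submodule.span_induction with
  | mem w hw =>
    obtain ⟨σ, z, rfl⟩ := hw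
    obtain ⟨hm, hc⟩ := χ.char_shift (p + q) p q le_rfl σ
    refine Submodule.subset_span ⟨⟨_, hm⟩, DirectSum.gMulLHom K (fun i => ⨂[K]^i E) a z, ?_⟩
    rw [hc, map_sub, map_smul]
    congr 1
    let L : ⨂[K]^p E →ₗ[K] ⨂[K]^q E →ₗ[K] ⨂[K]^(p + q) E :=
      (DirectSum.gMulLHom K (fun i => ⨂[K]^i E)).compl₂
        (PiTensorProduct.reindex K (fun _ => E) (σ : Equiv.Perm (Fin q))).toLinearMap
    let R : ⨂[K]^p E →ₗ[K] ⨂[K]^q E →ₗ[K] ⨂[K]^(p + q) E :=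
      (DirectSum.gMulLHom K (fun i => ⨂[K]^i E)).compr₂
        (PiTensorProduct.reindex K (fun _ => E)
          (shiftPerm (k := p) (p := q) (n := p + q) le_rfl σ)).toLinearMap
    suffices h : L = R from LinearMap.congr_fun (LinearMap.congr_fun h a) z
    refine PiTensorProduct.ext (MultilinearMap.ext fun x =>
      PiTensorProduct.ext (MultilinearMap.ext fun y => ?_))
    change GradedMonoid.GMul.mul (A := fun i => ⨂[K]^i E) (PiTensorProduct.tprod K x)
        (PiTensorProduct.reindex K (fun _ => E) _ (PiTensorProduct.tprod K y)) =
        PiTensorProduct.reindex K (fun _ => E) _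
        (GradedMonoid.GMul.mul (A := fun i => ⨂[K]^i E) (PiTensorProduct.tprod K x) (PiTensorProduct.tprod K y))
    rw [PiTensorProduct.reindex_tprod, TensorPower.tprod_mul_tprod, TensorPower.tprod_mul_tprod,
      PiTensorProduct.reindex_tprod]
    congr 1
    funext i
    rw [← Equiv.apply_symm_apply (shiftPerm (k := p) (p := q) (n := p + q) le_rfl
      (σ : Equiv.Perm (Fin q))) i, Equiv.symm_apply_apply]
    generalize (Equiv.symm _ i) = j
    refine Fin.addCases (fun j => ?_) (fun j => ?_) j
    · rw [shiftPerm_apply_of_notMem, Fin.append_left, Fin.append_left]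
      intro t ht
      have := congrArg Fin.val ht
      simp at this
      omega
    · have e : ∀ j, Fin.natAdd p j = shiftEmb (k := p) (p := q) (n := p + q) le_rfl j :=
        fun j => Fin.ext (by simp)
      rw [e, shiftPerm_apply, ← e, ← e, Fin.append_right, Fin.append_right,
        Equiv.symm_apply_apply]
  | zero => rw [map_zero]; exact zero_mem _
  | add x y _ _ hx hy => rw [map_add]; exact add_mem hx hy
  | smul c x _ hx => rw [map_smul]; exact Submodule.smul_mem _ c hx

/-- The multiplication `[χ]^p(E) × [χ]^q(E) → [χ]^{p+q}(E)` induced by that of the tensor algebra. -/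
def powerMul (p q : ℕ) : Power χ E p →ₗ[K] Power χ E q →ₗ[K] Power χ E (p + q) :=
  ((relSub χ E q).liftQ
    ((relSub χ E p).liftQ
      ((DirectSum.gMulLHom K (fun i => ⨂[K]^i E) (i := p) (j := q)).compr₂
        (relSub χ E (p + q)).mkQ)
      (fun a ha => by
        rw [LinearMap.mem_ker]
        refine LinearMap.ext fun b => ?_
        exact (Submodule.Quotient.mk_eq_zero _).2 (gMul_mem_left χ a b ha))).flip
    (fun b hb => by
      rw [LinearMap.mem_ker]
      refine LinearMap.ext fun a => ?_
      obtain ⟨a, rfl⟩ := (relSub χ E p).mkQ_surjective a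
      exact (Submodule.Quotient.mk_eq_zero _).2 (gMul_mem_right χ a b hb))).flip

variable (E)

instance instGMul : GradedMonoid.GMul (Power χ E) where
  mul {p q} a b := powerMul (E := E) χ p q a b

instance instGOne : GradedMonoid.GOne (Power χ E) where
  one := (relSub χ E 0).mkQ (GradedMonoid.GOne.one (A := fun i => ⨂[K]^i E))

/-- The canonical homomorphisms `φ_d : T^d(E) → [χ]^d(E)`, all degrees at once. -/
def gradedMk (a : GradedMonoid fun i => ⨂[K]^i E) : GradedMonoid (Power χ E) :=
  ⟨a.1, (relSub χ E a.1).mkQ a.2⟩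

theorem gradedMk_surjective : Function.Surjective (gradedMk χ E) := by
  rintro ⟨d, a⟩
  obtain ⟨a, rfl⟩ := (relSub χ E d).mkQ_surjective a
  exact ⟨⟨d, a⟩, rfl⟩

theorem gradedMk_mul (a b : GradedMonoid fun i => ⨂[K]^i E) :
    gradedMk χ E (a * b) = gradedMk χ E a * gradedMk χ E b := rfl

theorem gradedMk_one : gradedMk χ E 1 = 1 := rfl

instance instGSemiring : DirectSum.GSemiring (Power χ E) where
  one_mul := fun a => by
    obtain ⟨a, rfl⟩ := gradedMk_surjective χ E a
    rw [← gradedMk_one, ← gradedMk_mul, one_mul]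
  mul_one := fun a => by
    obtain ⟨a, rfl⟩ := gradedMk_surjective χ E a
    rw [← gradedMk_one, ← gradedMk_mul, mul_one]
  mul_assoc := fun a b c => by
    obtain ⟨a, rfl⟩ := gradedMk_surjective χ E a
    obtain ⟨b, rfl⟩ := gradedMk_surjective χ E b
    obtain ⟨c, rfl⟩ := gradedMk_surjective χ E c
    simp only [← gradedMk_mul, mul_assoc]
  mul_zero := fun a => map_zero (powerMul (E := E) χ _ _ a)
  zero_mul := fun b => LinearMap.map_zero₂ (powerMul (E := E) χ _ _) b
  mul_add := fun a b c => map_add (powerMul (E := E) χ _ _ a) b c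
  add_mul := fun a b c => LinearMap.map_add₂ (powerMul (E := E) χ _ _) a b c
  natCast := fun n => (relSub χ E 0).mkQ (TensorPower.algebraMap₀ (n : K))
  natCast_zero := by simp
  natCast_succ := fun n => by
    rw [Nat.cast_succ, map_add, TensorPower.algebraMap₀_one, map_add]
    rfl

/-- The unit `K → [χ](E)` of the graded algebra `[χ](E)`. -/
instance instGAlgebra : DirectSum.GAlgebra K (Power χ E) where
  toFun := ((relSub χ E 0).mkQ.comp
    (TensorPower.algebraMap₀ : K ≃ₗ[K] ⨂[K]^0 E).toLinearMap).toAddMonoidHom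
  map_one := congrArg (relSub χ E 0).mkQ TensorPower.algebraMap₀_one
  map_mul r s := congrArg (gradedMk χ E)
    (DirectSum.GAlgebra.map_mul (R := K) (A := fun i => ⨂[K]^i E) r s)
  commutes r x := by
    obtain ⟨a, rfl⟩ := gradedMk_surjective χ E x
    exact congrArg (gradedMk χ E) (DirectSum.GAlgebra.commutes r a)
  smul_def r x := by
    obtain ⟨a, rfl⟩ := gradedMk_surjective χ E x
    exact congrArg (gradedMk χ E) (DirectSum.GAlgebra.smul_def r a)

variable {E}

/-- The decomposable `d-χ`-vector `x_1 χ … χ x_d`, as an element of `[χ](E)`. -/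
def chiVec {d : ℕ} (x : Fin d → E) : SemiSymAlg χ E :=
  DirectSum.lof K ℕ (Power χ E) d ((relSub χ E d).mkQ (PiTensorProduct.tprod K x))

/-- The multiplication of `[χ](E)` is concatenation of decomposable `χ`-vectors. -/
theorem chiVec_mul_chiVec {p q : ℕ} (x : Fin p → E) (y : Fin q → E) :
    chiVec χ x * chiVec χ y = chiVec χ (Fin.append x y) := by
  refine (DirectSum.of_mul_of (A := Power χ E) _ _).trans ?_
  exact congrArg (fun t => DirectSum.lof K ℕ (Power χ E) (p + q) ((relSub χ E (p + q)).mkQ t))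
    (TensorPower.tprod_mul_tprod K x y)

/-- The relation `x_{σ(1)} χ … χ x_{σ(d)} = χ(σ) x_1 χ … χ x_d`, for `σ ∈ W_d`. -/
theorem chiVec_comp_perm {d : ℕ} (x : Fin d → E) (σ : χ.W d) :
    chiVec χ (x ∘ (σ : Equiv.Perm (Fin d))) = (χ.char d σ : K) • chiVec χ x := by
  unfold chiVec
  rw [← map_smul, ← map_smul]
  congr 1
  refine ((Submodule.Quotient.eq (relSub χ E d)).2 ?_).symm
  refine Submodule.subset_span ⟨σ⁻¹, PiTensorProduct.tprod K x, ?_⟩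
  rw [PiTensorProduct.reindex_tprod, map_inv, inv_inv]
  rfl

theorem relSub_zero : relSub χ E 0 = ⊥ := by
  refine (Submodule.span_eq_bot).2 ?_
  rintro w ⟨σ, z, rfl⟩
  obtain rfl : σ = 1 := Subtype.ext (Subsingleton.elim _ _)
  rw [map_one, inv_one, Units.val_one, one_smul, sub_eq_zero]
  exact (LinearEquiv.congr_fun (PiTensorProduct.reindex_refl (R := K) (s := fun _ : Fin 0 => E))
    z).symm

variable (E)

/-- The identification of `[χ]^0(E)` with `K`. -/
noncomputable def powerZeroEquiv : Power χ E 0 ≃ₗ[K] K :=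
  (Submodule.quotEquivOfEqBot _ (relSub_zero χ)).trans TensorPower.algebraMap₀.symm

/-- The linear form `ε_E` on `[χ](E)`: the identity on `[χ]^0(E) = K`, and zero on `[χ]^d(E)` for
`d > 0`. -/
noncomputable def counitForm : SemiSymAlg χ E →ₗ[K] K :=
  (powerZeroEquiv χ E).toLinearMap ∘ₗ DirectSum.component K ℕ (Power χ E) 0

/-- The homogeneous component of degree `n` of the graded `K`-module `[χ](E) ⊗ [χ](E)`. -/
def tensorDegree (n : ℕ) : Submodule K (SemiSymAlg χ E ⊗[K] SemiSymAlg χ E) :=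
  ⨆ s : Finset.HasAntidiagonal.antidiagonal n, LinearMap.range (TensorProduct.map
    (DirectSum.lof K ℕ (Power χ E) s.1.1) (DirectSum.lof K ℕ (Power χ E) s.1.2))

/-- The homogeneous component `([χ]^d(E))^*` of the graded dual: the linear forms on `[χ]^d(E)`,
extended by zero to `[χ](E)`. (`WithConv` is Mathlib's tag for a space of linear maps which is
going to be multiplied by convolution.) -/
def dualDegree (d : ℕ) : Submodule K (WithConv (SemiSymAlg χ E →ₗ[K] K)) :=
  LinearMap.range ((WithConv.linearEquiv K (SemiSymAlg χ E →ₗ[K] K)).symm.toLinearMap ∘ₗ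
    (DirectSum.component K ℕ (Power χ E) d).dualMap)

end Power

/-- The subgroup `W_p × ω^p(W_q)` of `W_n`, `n = p + q`. -/
noncomputable def blockSubgroup {p q n : ℕ} (h : p + q = n) : Subgroup (Equiv.Perm (Fin n)) :=
  (χ.W p).map (shiftPerm (k := 0) (p := p) (n := n) (by omega)) ⊔
    (χ.W q).map (shiftPerm (k := p) (p := q) (n := n) (by omega))

open Classical in
/-- The set `M(χ;n;p,q)` of lexicographically minimal representatives of the left classes
`ρ (W_p × ω^p(W_q))` in `W_n`; permutations are compared as words `(ρ(1), …, ρ(n))`. -/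
noncomputable def minReps {p q n : ℕ} (h : p + q = n) : Finset (χ.W n) :=
  {ρ | ∀ υ ∈ blockSubgroup χ h,
    toLex (⇑(ρ : Equiv.Perm (Fin n))) ≤ toLex (⇑((ρ : Equiv.Perm (Fin n)) * υ))}

/-- The right hand side of the formula for `c_E(x_1 χ … χ x_n)`: the sum over all `p + q = n` and
all `ρ ∈ M(χ;n;p,q)` of
`χ(ρ) (x_{ρ(1)} χ … χ x_{ρ(p)}) ⊗ (x_{ρ(p+1)} χ … χ x_{ρ(n)})`. -/
noncomputable def coproduct {E : Type*} [AddCommGroup E] [Module K E] {n : ℕ} (x : Fin n → E) :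
    SemiSymAlg χ E ⊗[K] SemiSymAlg χ E :=
  ∑ s : Finset.HasAntidiagonal.antidiagonal n,
    have h : s.1.1 + s.1.2 = n := Finset.HasAntidiagonal.mem_antidiagonal.1 s.2
    ∑ ρ ∈ minReps χ h, (χ.char n ρ : K) •
      (chiVec χ (fun i : Fin s.1.1 => x ((ρ : Equiv.Perm (Fin n))
          (shiftEmb (k := 0) (p := s.1.1) (n := n) (by omega) i))) ⊗ₜ[K]
        chiVec χ (fun i : Fin s.1.2 => x ((ρ : Equiv.Perm (Fin n))
          (shiftEmb (k := s.1.1) (p := s.1.2) (n := n) (by omega) i))))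

open Classical in
/-- The generalized Schur function
`d_χ(A) = ∑_{σ ∈ W_d} χ(σ) a_{σ⁻¹(1) 1} … a_{σ⁻¹(d) d}`. -/
noncomputable def schurFunction {d : ℕ} (A : Matrix (Fin d) (Fin d) K) : K :=
  ∑ σ : χ.W d, (χ.char d σ : K) * ∏ j, A ((σ : Equiv.Perm (Fin d))⁻¹ j) j

end SemiSym

/-! Everything rests on one fact: the characters of an `ω`-invariant sequence satisfy `χ(σ)² = 1`
(`OmegaInvariant.char_mul_self`). Summing over `W_n` with weights `χ(ρ)` produces expressions that
pick up `χ(τ)⁻¹` when the arguments are permuted by `τ`, while a decomposable `χ`-vector picks up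
`χ(τ)`. Only because these agree do the coproduct and the pairing descend to `[χ](E)`.

To prove the fact, embed all `W_d` in the finitary symmetric group of `ℕ`. Let `W` be their union
and `D` the kernel of the limit character, which contains all commutators of `W` and is stable under
the shift. If `σ` in `W` is shifted until its first moved point lands on the last moved point of
`σ`, the two supports meet in one point and the commutator is a three-cycle in `D`. Lying in a
common three-cycle of `D` generates no more than itself as an equivalence relation
(`IsTriangle.trans`). Elements of `W` preserve its classes (`linked_apply`), and a finitary
permutation preserving the classes has its square in `D` (`sq_mem_of_linked`).

As `K` contains `ℚ`, the sum over minimal coset representatives equals the sum over all of `W_n`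
divided by `|W_p| |W_q|`. In this averaged form a further symmetrization over a block only
contributes the order of its group (`symSum_sum_block`). Hence both sides of coassociativity are the
same sum of symmetrized three-fold splittings, and the pairing carries concatenation to convolution.
In each degree the pairing is bijective: `T^n(E^*)` is the dual of `T^n(E)` because `E` is finite
free, and dividing by `|W_n|` undoes the symmetrization. -/

namespace SemiSym

/-! ### Three-cycles in shift-stable finitary permutation groups -/

section Finitary

open Equiv

/-- The three-cycle `x ↦ y ↦ z ↦ x`. -/
def threeCycle (x y z : ℕ) : Perm ℕ := swap x y * swap y z

theorem threeCycle_rotate {x y z : ℕ} (h1 : x ≠ y) (h2 : y ≠ z) (h3 : x ≠ z) :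
    threeCycle x y z = threeCycle y z x := by
  ext i
  simp only [threeCycle, Perm.mul_apply, swap_apply_def]
  grind

theorem threeCycle_inv (x y z : ℕ) : (threeCycle x y z)⁻¹ = threeCycle z y x := by
  simp [threeCycle, swap_comm]

theorem conj_threeCycle (g : Perm ℕ) (x y z : ℕ) :
    g * threeCycle x y z * g⁻¹ = threeCycle (g x) (g y) (g z) := by
  simp only [threeCycle, swap_apply_apply]
  group

theorem threeCycle_apply_fst {x y z : ℕ} (h1 : x ≠ y) (h3 : x ≠ z) :
    threeCycle x y z x = y := by
  rw [threeCycle, Perm.mul_apply, swap_apply_of_ne_of_ne h1 h3, swap_apply_left]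

theorem threeCycle_apply_snd {x y z : ℕ} (h2 : y ≠ z) (h3 : x ≠ z) :
    threeCycle x y z y = z := by
  rw [threeCycle, Perm.mul_apply, swap_apply_left, swap_apply_of_ne_of_ne h3.symm h2.symm]

theorem threeCycle_apply_trd (x y z : ℕ) : threeCycle x y z z = x := by
  simp [threeCycle]

theorem threeCycle_apply_of_ne {x y z i : ℕ} (h1 : i ≠ x) (h2 : i ≠ y) (h3 : i ≠ z) :
    threeCycle x y z i = i := by
  simp [threeCycle, swap_apply_of_ne_of_ne, *]

/-- The permutation `ω ^ k (g)` of `ℕ`. -/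
noncomputable def natShift (k : ℕ) : Perm ℕ →* Perm ℕ :=
  Perm.viaEmbeddingHom (addLeftEmbedding k)

theorem natShift_apply_add (k : ℕ) (g : Perm ℕ) (i : ℕ) : natShift k g (k + i) = k + g i :=
  Perm.viaEmbedding_apply g (addLeftEmbedding k) i

theorem natShift_apply_of_lt (k : ℕ) (g : Perm ℕ) {i : ℕ} (h : i < k) : natShift k g i = i :=
  Perm.viaEmbedding_apply_of_notMem g (addLeftEmbedding k) i
    (by rintro ⟨j, rfl⟩; simp at h)

theorem natShift_swap (k x y : ℕ) : natShift k (swap x y) = swap (k + x) (k + y) := by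
  ext i
  rcases lt_or_ge i k with h | h
  · rw [natShift_apply_of_lt _ _ h, swap_apply_of_ne_of_ne] <;> omega
  · obtain ⟨j, rfl⟩ := Nat.exists_eq_add_of_le h
    rw [natShift_apply_add]
    simp only [swap_apply_def]
    grind

theorem natShift_threeCycle (k x y z : ℕ) :
    natShift k (threeCycle x y z) = threeCycle (k + x) (k + y) (k + z) := by
  simp [threeCycle, natShift_swap]

/-- Two permutations whose supports meet in a single point have a three-cycle as commutator. -/
theorem commutator_eq_threeCycle {σ τ : Perm ℕ} {b : ℕ} (hσ : σ b ≠ b) (hτ : τ b ≠ b)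
    (h : ∀ i, i ≠ b → σ i = i ∨ τ i = i) :
    σ * τ * σ⁻¹ * τ⁻¹ = threeCycle b (σ b) (τ b) := by
  have e : σ * τ = threeCycle b (σ b) (τ b) * τ * σ := by
    ext i
    simp only [Perm.mul_apply]
    have hσb : σ (σ b) ≠ σ b := fun h' => hσ (σ.injective h')
    have hτb : τ (τ b) ≠ τ b := fun h' => hτ (τ.injective h')
    have hσb' := (h _ hσ).resolve_left hσb
    have hτb' := (h _ hτ).resolve_right hτb
    have hne : σ b ≠ τ b := fun h' => hτb (h' ▸ hσb')
    by_cases hb : i = b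
    · rw [hb, hσb', threeCycle_apply_snd hne hτ.symm, hτb']
    by_cases hi : σ i = i
    · rw [hi]
      by_cases hi' : τ i = b
      · rw [hi', threeCycle_apply_fst hσ.symm hτ.symm]
      · have h1 : τ i ≠ τ b := fun h' => hb (τ.injective h')
        have h2 : τ i ≠ σ b := fun h' => hb (σ.injective (by
          rw [hi]; exact τ.injective (h'.trans hσb'.symm)))
        rw [threeCycle_apply_of_ne hi' h2 h1]
        by_cases hi2 : τ i = i
        · rw [hi2, hi]
        · exact (h _ hi').resolve_right fun h' => hi2 (τ.injective h')
    · rw [(h i hb).resolve_left hi]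
      by_cases hi' : σ i = b
      · rw [hi', threeCycle_apply_trd]
      · have h1 : σ i ≠ σ b := fun h' => hb (σ.injective h')
        have h2 : σ i ≠ τ b := fun h' => hi (by rw [σ.injective (h'.trans hτb'.symm), hτb'])
        rw [(h _ hi').resolve_left fun h' => hi (σ.injective h'),
          threeCycle_apply_of_ne hi' h1 h2]
  rw [e]
  group

/-- `x`, `y`, `z` are distinct and the three-cycle `x ↦ y ↦ z ↦ x` belongs to `D`. -/
def IsTriangle (D : Subgroup (Perm ℕ)) (x y z : ℕ) : Prop :=
  x ≠ y ∧ y ≠ z ∧ x ≠ z ∧ threeCycle x y z ∈ D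

variable {W D : Subgroup (Perm ℕ)}

theorem IsTriangle.rotate {x y z : ℕ} (h : IsTriangle D x y z) : IsTriangle D y z x :=
  ⟨h.2.1, h.2.2.1.symm, h.1.symm, threeCycle_rotate h.1 h.2.1 h.2.2.1 ▸ h.2.2.2⟩

theorem IsTriangle.reverse {x y z : ℕ} (h : IsTriangle D x y z) : IsTriangle D z y x :=
  ⟨h.2.1.symm, h.1.symm, h.2.2.1.symm, threeCycle_inv x y z ▸ D.inv_mem h.2.2.2⟩

theorem IsTriangle.conj {x y z : ℕ} (h : IsTriangle D x y z) {g : Perm ℕ}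
    (hg : ∀ d ∈ D, g * d * g⁻¹ ∈ D) : IsTriangle D (g x) (g y) (g z) :=
  ⟨g.injective.ne h.1, g.injective.ne h.2.1, g.injective.ne h.2.2.1,
    conj_threeCycle g x y z ▸ hg _ h.2.2.2⟩

theorem IsTriangle.shift (hD : ∀ d ∈ D, natShift 1 d ∈ D) {x y z : ℕ} (h : IsTriangle D x y z)
    (k : ℕ) : IsTriangle D (k + x) (k + y) (k + z) := by
  induction k with
  | zero => simpa using h
  | succ k ih =>
    obtain ⟨h1, h2, h3, h4⟩ := ih
    refine ⟨by omega, by omega, by omega, ?_⟩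
    have := hD _ h4
    rw [natShift_threeCycle] at this
    convert this using 2 <;> ring

theorem IsTriangle.conj_triangle {x y z a b c : ℕ} (h : IsTriangle D x y z)
    (h' : IsTriangle D a b c) : IsTriangle D (threeCycle a b c x) (threeCycle a b c y)
      (threeCycle a b c z) :=
  h.conj fun _ hd => D.mul_mem (D.mul_mem h'.2.2.2 hd) (D.inv_mem h'.2.2.2)

/-- Conjugating one three-cycle by the other moves its points while staying in `D`. Two such
conjugations produce `x, y, z` both when the third points `u, v` coincide and when all five points
are distinct; the cases `u = z` and `v = x` are immediate. -/
theorem IsTriangle.trans {x y z u v : ℕ} (h : IsTriangle D x y u) (h' : IsTriangle D y z v)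
    (hxz : x ≠ z) : IsTriangle D x y z := by
  have hxy := h.1
  have hyz := h'.1
  by_cases huz : u = z
  · exact huz ▸ h
  by_cases hvx : v = x
  · subst hvx; exact h'.rotate.rotate
  by_cases huv : u = v
  · subst huv
    have := h'.conj_triangle h
    rw [threeCycle_apply_snd h.2.1 h.2.2.1, threeCycle_apply_trd,
      threeCycle_apply_of_ne hxz.symm hyz.symm (Ne.symm huz)] at this
    have := this.conj_triangle h
    rw [threeCycle_apply_trd, threeCycle_apply_of_ne hxz.symm hyz.symm (Ne.symm huz),
      threeCycle_apply_fst h.1 h.2.2.1] at this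
    exact this.rotate.reverse
  · have h1 := h.conj_triangle h'
    rw [threeCycle_apply_of_ne hxy hxz (Ne.symm hvx), threeCycle_apply_fst h'.1 h'.2.2.1,
      threeCycle_apply_of_ne h.2.1.symm huz huv] at h1
    have := h.conj_triangle h1
    rw [threeCycle_apply_fst h1.1 h1.2.2.1, threeCycle_apply_of_ne hxy.symm hyz h.2.1,
      threeCycle_apply_trd] at this
    exact this.reverse

/-- Two points are equal or lie in the support of a common three-cycle of `D`. -/
def Linked (D : Subgroup (Perm ℕ)) (x y : ℕ) : Prop := x = y ∨ ∃ z, IsTriangle D x y z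

theorem Linked.symm {x y : ℕ} (h : Linked D x y) : Linked D y x := by
  rcases h with rfl | ⟨z, h⟩
  · exact .inl rfl
  · exact .inr ⟨z, h.reverse.rotate⟩

theorem Linked.isTriangle {x y z : ℕ} (h : Linked D x y) (h' : Linked D y z) (hxy : x ≠ y)
    (hyz : y ≠ z) (hxz : x ≠ z) : IsTriangle D x y z := by
  obtain ⟨u, hu⟩ := h.resolve_left hxy
  obtain ⟨v, hv⟩ := h'.resolve_left hyz
  exact hu.trans hv hxz

theorem Linked.trans {x y z : ℕ} (h : Linked D x y) (h' : Linked D y z) : Linked D x z := by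
  by_cases hxy : x = y
  · exact hxy ▸ h'
  by_cases hyz : y = z
  · exact hyz ▸ h
  by_cases hxz : x = z
  · exact .inl hxz
  exact .inr ⟨y, (h.isTriangle h' hxy hyz hxz).reverse.rotate.rotate⟩

theorem Linked.conj {x y : ℕ} (h : Linked D x y) {g : Perm ℕ}
    (hg : ∀ d ∈ D, g * d * g⁻¹ ∈ D) : Linked D (g x) (g y) :=
  h.imp (congrArg g) fun ⟨_, h⟩ => ⟨_, h.conj hg⟩

theorem Linked.shift (hD : ∀ d ∈ D, natShift 1 d ∈ D) {x y : ℕ} (h : Linked D x y) (k : ℕ) :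
    Linked D (k + x) (k + y) :=
  h.imp (congrArg _) fun ⟨_, h⟩ => ⟨_, h.shift hD k⟩

/-- If the partner `y` lies below `x`, shifting the pair by `x - y` puts `x` in the lower position.
-/
theorem exists_linked_gt (hD : ∀ d ∈ D, natShift 1 d ∈ D) {x y : ℕ} (h : Linked D x y)
    (hxy : x ≠ y) : ∃ z > x, Linked D x z := by
  rcases lt_or_gt_of_ne hxy with h' | h'
  · exact ⟨y, h', h⟩
  · have := h.shift hD (x - y)
    rw [Nat.sub_add_cancel h'.le] at this
    exact ⟨x - y + x, by omega, this.symm⟩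

theorem exists_linked_ge (hD : ∀ d ∈ D, natShift 1 d ∈ D) {x y : ℕ} (h : Linked D x y)
    (hxy : x ≠ y) (N : ℕ) : ∃ z > x, N ≤ z ∧ Linked D x z := by
  induction N with
  | zero =>
    obtain ⟨z, h1, h2⟩ := exists_linked_gt hD h hxy
    exact ⟨z, h1, by omega, h2⟩
  | succ N ih =>
    obtain ⟨z, h1, h2, h3⟩ := ih
    obtain ⟨w, h4, h5⟩ := exists_linked_gt hD h3.symm (by omega)
    exact ⟨w, by omega, by omega, h3.trans h5⟩

theorem natShift_mem (hW : ∀ g ∈ W, natShift 1 g ∈ W) {g : Perm ℕ} (hg : g ∈ W) (k : ℕ) :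
    natShift k g ∈ W := by
  induction k with
  | zero =>
    suffices e : natShift 0 g = g from e.symm ▸ hg
    ext i
    simpa using natShift_apply_add 0 g i
  | succ k ih =>
    suffices e : natShift (k + 1) g = natShift 1 (natShift k g) from e ▸ hW _ ih
    ext i
    rcases i with _ | i
    · rw [natShift_apply_of_lt _ _ (by omega), natShift_apply_of_lt _ _ (by omega)]
    · rw [add_comm i, natShift_apply_add]
      rcases lt_or_ge i k with h | h
      · rw [natShift_apply_of_lt _ _ (by omega), natShift_apply_of_lt _ _ (by omega)]
      · obtain ⟨j, rfl⟩ := Nat.exists_eq_add_of_le h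
        rw [natShift_apply_add, show 1 + (k + j) = k + 1 + j by ring, natShift_apply_add]
        ring

/-- Let `a` be the first point moved by `σ`. The shift of `σ` by `b - a` fixes everything below `b`
and moves `b`, whereas `σ` fixes everything above `b`. The supports meet in `b` only, so the
commutator is a three-cycle through `b` and `σ b`. -/
theorem exists_linked_last (hW : ∀ g ∈ W, natShift 1 g ∈ W)
    (hc : ∀ g ∈ W, ∀ h ∈ W, g * h * g⁻¹ * h⁻¹ ∈ D) {σ : Perm ℕ} (hσ : σ ∈ W) {b : ℕ}
    (hb : σ b ≠ b) (hlast : ∀ i > b, σ i = i) : Linked D b (σ b) := by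
  classical
  have hex : ∃ a, σ a ≠ a := ⟨b, hb⟩
  set a := Nat.find hex with ha
  have ha1 : σ a ≠ a := Nat.find_spec hex
  have ha2 : ∀ i < a, σ i = i := fun i hi => by simpa using Nat.find_min hex hi
  have hab : a ≤ b := Nat.find_min' hex hb
  have hτ := natShift_mem hW hσ (b - a)
  have e1 : natShift (b - a) σ b = b - a + σ a := by
    have := natShift_apply_add (b - a) σ a
    rwa [Nat.sub_add_cancel hab] at this
  have e2 : ∀ i < b, natShift (b - a) σ i = i := by
    intro i hi
    rcases lt_or_ge i (b - a) with h | h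
    · exact natShift_apply_of_lt _ _ h
    · obtain ⟨j, rfl⟩ := Nat.exists_eq_add_of_le h
      rw [natShift_apply_add, ha2 j (by omega)]
  have e3 : natShift (b - a) σ b ≠ b := by rw [e1]; omega
  have key := commutator_eq_threeCycle hb e3 fun i hi => by
    rcases lt_or_gt_of_ne hi with h | h
    · exact .inr (e2 i h)
    · exact .inl (hlast i h)
  have h5 : σ b < b := by
    by_contra h
    have := hlast (σ b) (by omega)
    exact hb (σ.injective this)
  have h6 : b < natShift (b - a) σ b := by
    by_contra h
    exact e3 ((natShift (b - a) σ).injective (e2 _ (by omega)))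
  exact .inr ⟨_, hb.symm, by omega, by omega, key ▸ hc _ hσ _ hτ⟩

/-- A point moved by a shift-stable finitary group `W` is linked to another point. -/
theorem exists_linked_ne (hW : ∀ g ∈ W, natShift 1 g ∈ W) (hD : ∀ d ∈ D, natShift 1 d ∈ D)
    (hfin : ∀ g ∈ W, ∃ N, ∀ i ≥ N, g i = i) (hn : ∀ g ∈ W, ∀ d ∈ D, g * d * g⁻¹ ∈ D)
    (hc : ∀ g ∈ W, ∀ h ∈ W, g * h * g⁻¹ * h⁻¹ ∈ D) {σ : Perm ℕ} (hσ : σ ∈ W) {x : ℕ}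
    (hx : σ x ≠ x) : ∃ y, x ≠ y ∧ Linked D x y := by
  classical
  have hlast : ∀ g ∈ W, ∀ i, g i ≠ i → ∃ b, g b ≠ b ∧ ∀ i > b, g i = i := by
    intro g hg i hi
    obtain ⟨N, hN⟩ := hfin g hg
    have hb : ∀ j, g j ≠ j → j ≤ N := fun j hj => by
      by_contra h; exact hj (hN j (by omega))
    refine ⟨Nat.findGreatest (fun j => g j ≠ j) N,
      Nat.findGreatest_spec (P := fun j => g j ≠ j) (hb i hi) hi, fun j hj => ?_⟩
    by_contra h
    exact absurd (Nat.le_findGreatest (P := fun j => g j ≠ j) (hb j h) h) (by omega)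
  obtain ⟨b, hb1, hb2⟩ := hlast σ hσ x hx
  have hbl := exists_linked_last hW hc hσ hb1 hb2
  -- Shifting the link at `b` settles all points from `b` on.
  have hup : ∀ j ≥ b, ∃ y, j ≠ y ∧ Linked D j y := by
    intro j hj
    obtain ⟨k, rfl⟩ := Nat.exists_eq_add_of_le' hj
    exact ⟨k + σ b, by omega, hbl.shift hD k⟩
  -- descending induction on the moved point
  suffices h : ∀ m, ∀ y, b ≤ y + m → ∀ g ∈ W, g y ≠ y → ∃ z, y ≠ z ∧ Linked D y z from
    h b x (by omega) σ hσ hx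
  intro m
  induction m with
  | zero => exact fun y hy _ _ _ => hup y hy
  | succ m ih =>
    intro y hy g hg hgy
    -- If `g` moves `y` up, the link at `g y` is pulled back by `g⁻¹`. If it moves `y` down, the
    -- shift of `g` by `k = y - g y` carries the larger point `k + y` to `y`, and the link at `k +
    -- y` is pushed forward.
    by_cases hlt : y < g y
    · obtain ⟨z, hz1, hz2⟩ := ih (g y) (by omega) g hg (fun h => hgy (g.injective h))
      refine ⟨g⁻¹ z, fun h => hz1 ?_, ?_⟩
      · rw [h]; simp
      · simpa using hz2.conj (hn _ (W.inv_mem hg))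
    · set k := y - g y with hk
      have hmem := natShift_mem hW hg k
      have e : natShift k g (k + y) = y := by rw [natShift_apply_add]; omega
      obtain ⟨z, hz1, hz2⟩ := ih (k + y) (by omega) _ hmem (by omega)
      refine ⟨natShift k g z, fun h => hz1 ?_, ?_⟩
      · exact (natShift k g).injective (e.trans h)
      · simpa [e] using hz2.conj (hn _ hmem)

/-- A moved point `x` is linked to points arbitrarily far out, hence to some `z` fixed by `σ`.
Conjugation by `σ` links `σ x` to `σ z = z` as well. -/
theorem linked_apply (hW : ∀ g ∈ W, natShift 1 g ∈ W) (hD : ∀ d ∈ D, natShift 1 d ∈ D)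
    (hfin : ∀ g ∈ W, ∃ N, ∀ i ≥ N, g i = i) (hn : ∀ g ∈ W, ∀ d ∈ D, g * d * g⁻¹ ∈ D)
    (hc : ∀ g ∈ W, ∀ h ∈ W, g * h * g⁻¹ * h⁻¹ ∈ D) {σ : Perm ℕ} (hσ : σ ∈ W) (x : ℕ) :
    Linked D x (σ x) := by
  by_cases hx : σ x = x
  · exact .inl hx.symm
  obtain ⟨y, h1, h2⟩ := exists_linked_ne hW hD hfin hn hc hσ hx
  obtain ⟨N, hN⟩ := hfin σ hσ
  obtain ⟨z, -, h3, h4⟩ := exists_linked_ge hD h2 h1 N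
  have := h4.conj (hn σ hσ)
  rw [hN z h3] at this
  exact h4.trans this.symm

/-- Peeling one transposition off `π` changes its square by a product of two transpositions with a
common point. This product is trivial or a three-cycle on linked points, so induction on the support
applies. -/
theorem sq_mem_of_linked (N : ℕ) : ∀ π : Perm ℕ, (∀ i ≥ N, π i = i) →
    (∀ x, Linked D x (π x)) → π * π ∈ D := by
  induction N with
  | zero =>
    intro π h _
    rw [show π = 1 from Equiv.ext fun i => h i (Nat.zero_le i), one_mul]
    exact D.one_mem
  | succ N ih =>
    intro π h hl
    by_cases hN : π N = N
    · exact ih π (fun i hi => hi.eq_or_lt.elim (fun e => e ▸ hN) fun h' => h i h') hl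
    set y := π N with hy
    -- This `ρ` fixes `N` and every point above it, and still moves points only within link classes
    -- because `N` and `y` are linked.
    set ρ := swap N y * π with hρ
    have hρN : ρ N = N := by simp [hρ, ← hy]
    have hρ2 : ρ * ρ ∈ D := by
      refine ih ρ (fun i hi => ?_) fun x => ?_
      · rcases hi.eq_or_lt with rfl | h'
        · exact hρN
        · have e := h i h'
          rw [hρ, Perm.mul_apply, e, swap_apply_of_ne_of_ne (by omega)]
          rintro rfl
          exact hN (π.injective e)
      · refine (hl x).trans ?_
        simp only [hρ, Perm.mul_apply, swap_apply_def]
        split_ifs with h1 h2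
        · rw [h1]; exact hl N
        · rw [h2]; exact (hl N).symm
        · exact .inl rfl
    have hρl : Linked D y (ρ y) := by
      refine (hl y).trans ?_
      simp only [hρ, Perm.mul_apply, swap_apply_def]
      split_ifs with h1 h2
      · rw [h1]; exact hl N
      · rw [h2]; exact (hl N).symm
      · exact .inl rfl
    -- Both factors are `swap N y * ρ`. Moving the first `ρ` past the second transposition
    -- conjugates it, and `ρ` fixes `N`.
    have e : π * π = swap N y * swap N (ρ y) * (ρ * ρ) := by
      have e1 : π = swap N y * ρ := by simp [hρ, ← mul_assoc]
      have e2 : swap N (ρ y) = ρ * swap N y * ρ⁻¹ := by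
        rw [← swap_apply_apply, hρN]
      rw [e2]
      nth_rw 1 [e1]
      nth_rw 1 [e1]
      group
    rw [e]
    refine D.mul_mem ?_ hρ2
    by_cases hyy : ρ y = y
    · rw [hyy, swap_mul_self]; exact D.one_mem
    · have hNy : N ≠ ρ y := fun h' => hN (ρ.injective (hρN.trans h')).symm
      rw [swap_comm N y]
      exact ((hl N).symm.isTriangle ((hl N).trans hρl) hN hNy (Ne.symm hyy)).2.2.2

end Finitary

/-! ### The characters square to one -/

section CharSq

open Equiv

/-- The inclusion of `S_d` in the finitary symmetric group of `ℕ`. -/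
noncomputable def natPerm (d : ℕ) : Perm (Fin d) →* Perm ℕ :=
  Perm.viaEmbeddingHom Fin.valEmbedding

theorem natPerm_apply {d : ℕ} (σ : Perm (Fin d)) (i : Fin d) : natPerm d σ i = σ i :=
  Perm.viaEmbedding_apply σ Fin.valEmbedding i

theorem natPerm_apply_of_le {d : ℕ} (σ : Perm (Fin d)) {i : ℕ} (h : d ≤ i) :
    natPerm d σ i = i :=
  Perm.viaEmbedding_apply_of_notMem σ Fin.valEmbedding i
    (by rintro ⟨j, rfl⟩; exact absurd j.2 (not_lt.2 h))

theorem natPerm_injective (d : ℕ) : Function.Injective (natPerm d) :=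
  Perm.viaEmbeddingHom_injective _

theorem natPerm_shiftPerm {k p n : ℕ} (h : k + p ≤ n) (σ : Perm (Fin p)) :
    natPerm n (shiftPerm h σ) = natShift k (natPerm p σ) := by
  ext i
  rcases lt_or_ge i n with hi | hi
  · rw [show i = ((⟨i, hi⟩ : Fin n) : ℕ) from rfl, natPerm_apply]
    by_cases hj : ∃ j, shiftEmb h j = ⟨i, hi⟩
    · obtain ⟨j, hj⟩ := hj
      rw [← hj, shiftPerm_apply, shiftEmb_val, shiftEmb_val, natShift_apply_add, natPerm_apply]
    · push Not at hj
      rw [shiftPerm_apply_of_notMem h σ _ hj]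
      rcases lt_or_ge i k with hk | hk
      · rw [natShift_apply_of_lt _ _ hk]
      · obtain ⟨j, rfl⟩ := Nat.exists_eq_add_of_le hk
        rw [natShift_apply_add, natPerm_apply_of_le]
        by_contra hp
        exact hj ⟨j, by omega⟩ rfl
  · rw [natPerm_apply_of_le _ hi]
    obtain ⟨j, rfl⟩ := Nat.exists_eq_add_of_le (show k ≤ i by omega)
    rw [natShift_apply_add, natPerm_apply_of_le _ (by omega)]

variable {K : Type*} [CommRing K] (χ : OmegaInvariant K)

/-- Permutations of different degrees can thus be compared and multiplied in a common degree without
altering their characters. -/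
theorem OmegaInvariant.exists_natPerm_eq {d n : ℕ} (h : d ≤ n) (σ : χ.W d) :
    ∃ τ : χ.W n, natPerm n τ = natPerm d σ ∧ χ.char n τ = χ.char d σ := by
  obtain ⟨h1, h2⟩ := χ.char_shift n 0 d (by omega) σ
  refine ⟨⟨_, h1⟩, ?_, h2⟩
  rw [natPerm_shiftPerm]
  ext i
  simpa using natShift_apply_add 0 (natPerm d (σ : Perm (Fin d))) i

/-- The union of the kernels of the restrictions of `φ ∘ χ_d`, in the finitary symmetric group. -/
def OmegaInvariant.limitKer {G : Type*} [CommGroup G] (φ : Kˣ →* G) : Subgroup (Perm ℕ) where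
  carrier := {g | ∃ (d : ℕ) (σ : χ.W d), natPerm d σ = g ∧ φ (χ.char d σ) = 1}
  mul_mem' := by
    rintro _ _ ⟨d, σ, rfl, h1⟩ ⟨e, τ, rfl, h2⟩
    obtain ⟨σ', h3, h4⟩ := χ.exists_natPerm_eq (le_max_left d e) σ
    obtain ⟨τ', h5, h6⟩ := χ.exists_natPerm_eq (le_max_right d e) τ
    exact ⟨_, σ' * τ', by simp [h3, h5], by simp [h4, h6, h1, h2]⟩
  one_mem' := ⟨0, 1, by simp, by simp⟩
  inv_mem' := by
    rintro _ ⟨d, σ, rfl, h⟩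
    exact ⟨d, σ⁻¹, by simp, by simp [h]⟩

theorem OmegaInvariant.natShift_mem_limitKer {G : Type*} [CommGroup G] (φ : Kˣ →* G)
    {g : Perm ℕ} (hg : g ∈ χ.limitKer φ) : natShift 1 g ∈ χ.limitKer φ := by
  obtain ⟨d, σ, rfl, h⟩ := hg
  exact ⟨d + 1, ⟨_, χ.omega_mem d σ⟩, natPerm_shiftPerm _ _, by rw [χ.char_omega, h]⟩

/-- The characters of an `ω`-invariant sequence have values `ε` with `ε ^ 2 = 1`. -/
theorem OmegaInvariant.char_mul_self (d : ℕ) (σ : χ.W d) : χ.char d σ * χ.char d σ = 1 := by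
  -- The trivial homomorphism imposes no condition and gives the union of all `W_d`; the identity
  -- gives the kernel of the limit character.
  let W := χ.limitKer (1 : Kˣ →* Kˣ)
  let D := χ.limitKer (MonoidHom.id Kˣ)
  have hfin : ∀ g ∈ W, ∃ N, ∀ i ≥ N, g i = i := by
    rintro _ ⟨d, σ, rfl, -⟩
    exact ⟨d, fun i hi => natPerm_apply_of_le _ hi⟩
  have hc : ∀ g ∈ W, ∀ h ∈ W, g * h * g⁻¹ * h⁻¹ ∈ D := by
    rintro _ ⟨d, σ, rfl, -⟩ _ ⟨e, τ, rfl, -⟩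
    obtain ⟨σ', h3, h4⟩ := χ.exists_natPerm_eq (le_max_left d e) σ
    obtain ⟨τ', h5, h6⟩ := χ.exists_natPerm_eq (le_max_right d e) τ
    refine ⟨_, σ' * τ' * σ'⁻¹ * τ'⁻¹, by simp [h3, h5], ?_⟩
    simp only [MonoidHom.id_apply, map_mul, map_inv]
    rw [mul_right_comm (χ.char _ σ'), mul_inv_cancel, one_mul, mul_inv_cancel]
  have hDW : ∀ d ∈ D, d ∈ W := by
    rintro _ ⟨d, σ, rfl, -⟩
    exact ⟨d, σ, rfl, rfl⟩
  have hn : ∀ g ∈ W, ∀ d ∈ D, g * d * g⁻¹ ∈ D := fun g hg d hd => by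
    simpa using D.mul_mem (hc g hg d (hDW d hd)) hd
  have hσ : natPerm d σ ∈ W := ⟨d, σ, rfl, rfl⟩
  obtain ⟨e, τ, h1, h2⟩ : natPerm d σ * natPerm d σ ∈ D :=
    sq_mem_of_linked d _ (fun i hi => natPerm_apply_of_le _ hi) fun x =>
      linked_apply (fun g => χ.natShift_mem_limitKer _) (fun g => χ.natShift_mem_limitKer _)
        hfin hn hc hσ x
  -- The witness `τ` that the square lies in `D` may have another degree `e`. In degree `max d e` it
  -- coincides with the square, by injectivity of `natPerm`.
  obtain ⟨σ', h3, h4⟩ := χ.exists_natPerm_eq (le_max_left d e) σ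
  obtain ⟨τ', h5, h6⟩ := χ.exists_natPerm_eq (le_max_right d e) τ
  have e1 : τ' = σ' * σ' := Subtype.ext (natPerm_injective _ (by simp [h3, h5, h1]))
  rw [← h4, ← map_mul, ← e1, h6]
  exact h2

theorem OmegaInvariant.char_inv (d : ℕ) (σ : χ.W d) : (χ.char d σ)⁻¹ = χ.char d σ :=
  inv_eq_of_mul_eq_one_right (χ.char_mul_self d σ)

end CharSq

variable {K : Type*} [CommRing K] (χ : OmegaInvariant K)

/-! ### Block subgroups, coset representatives and symmetrization -/

section Characters

theorem OmegaInvariant.char_val_mul_self {d : ℕ} (σ : χ.W d) :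
    (χ.char d σ : K) * χ.char d σ = 1 := by
  rw [← Units.val_mul, χ.char_mul_self, Units.val_one]

/-- The homomorphism `W_p → W_n` given by `ω ^ k`. -/
noncomputable def OmegaInvariant.shiftHom {k p n : ℕ} (h : k + p ≤ n) : χ.W p →* χ.W n :=
  ((shiftPerm h).comp (χ.W p).subtype).codRestrict (χ.W n) fun σ => (χ.char_shift n k p h σ).1

@[simp] theorem OmegaInvariant.coe_shiftHom {k p n : ℕ} (h : k + p ≤ n) (σ : χ.W p) :
    (χ.shiftHom h σ : Equiv.Perm (Fin n)) = shiftPerm h σ := rfl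

@[simp] theorem OmegaInvariant.char_shiftHom {k p n : ℕ} (h : k + p ≤ n) (σ : χ.W p) :
    χ.char n (χ.shiftHom h σ) = χ.char p σ := (χ.char_shift n k p h σ).2

theorem shiftPerm_injective {k p n : ℕ} (h : k + p ≤ n) : Function.Injective (shiftPerm h) :=
  Equiv.Perm.viaEmbeddingHom_injective _

theorem shiftPerm_apply_of_disjoint {k p j q n : ℕ} (h : k + p ≤ n) (h' : j + q ≤ n)
    (hd : j + q ≤ k ∨ k + p ≤ j) (σ : Equiv.Perm (Fin p)) (i : Fin q) :
    shiftPerm h σ (shiftEmb h' i) = shiftEmb h' i := by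
  refine shiftPerm_apply_of_notMem h σ _ fun t ht => ?_
  have := congrArg Fin.val ht
  simp only [shiftEmb_val] at this
  omega

theorem shiftPerm_commute {k p j q n : ℕ} (h : k + p ≤ n) (h' : j + q ≤ n)
    (hd : j + q ≤ k ∨ k + p ≤ j) (σ : Equiv.Perm (Fin p)) (τ : Equiv.Perm (Fin q)) :
    Commute (shiftPerm h σ) (shiftPerm h' τ) := by
  refine Equiv.Perm.Disjoint.commute fun i => ?_
  by_cases hi : ∃ t, shiftEmb h' t = i
  · obtain ⟨t, rfl⟩ := hi
    exact .inl (shiftPerm_apply_of_disjoint h h' hd σ t)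
  · push Not at hi
    exact .inr (shiftPerm_apply_of_notMem h' τ i hi)

/-- The homomorphism `W_p × W_q → W_n` onto `W_p × ω ^ p (W_q)`. -/
noncomputable def OmegaInvariant.blockHom {p q n : ℕ} (h : p + q = n) :
    χ.W p × χ.W q →* χ.W n :=
  (χ.shiftHom (k := 0) (by omega)).noncommCoprod (χ.shiftHom (k := p) (by omega)) fun σ τ =>
    Subtype.ext (shiftPerm_commute _ _ (by omega) σ.1 τ.1)

theorem OmegaInvariant.blockHom_apply {p q n : ℕ} (h : p + q = n) (σ : χ.W p) (τ : χ.W q) :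
    χ.blockHom h (σ, τ) =
      χ.shiftHom (k := 0) (by omega) σ * χ.shiftHom (k := p) (by omega) τ := rfl

theorem OmegaInvariant.char_blockHom {p q n : ℕ} (h : p + q = n) (σ : χ.W p) (τ : χ.W q) :
    χ.char n (χ.blockHom h (σ, τ)) = χ.char p σ * χ.char q τ := by
  rw [χ.blockHom_apply, map_mul, χ.char_shiftHom, χ.char_shiftHom]

theorem OmegaInvariant.blockHom_injective {p q n : ℕ} (h : p + q = n) :
    Function.Injective (χ.blockHom h) := by
  rw [injective_iff_map_eq_one]
  rintro ⟨σ, τ⟩ hστ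
  have e : shiftPerm (k := 0) (n := n) (by omega) (σ : Equiv.Perm (Fin p)) *
      shiftPerm (k := p) (n := n) (by omega) (τ : Equiv.Perm (Fin q)) = 1 :=
    congrArg Subtype.val hστ
  have hσ : (σ : Equiv.Perm (Fin p)) = 1 := by
    ext1 i
    have := congrArg (fun g : Equiv.Perm (Fin n) => g (shiftEmb (k := 0) (by omega) i)) e
    simp only [Equiv.Perm.mul_apply] at this
    rw [shiftPerm_apply_of_disjoint _ _ (by omega), shiftPerm_apply] at this
    exact (shiftEmb _).injective this
  rw [hσ, map_one, one_mul] at e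
  have hτ := shiftPerm_injective _ (e.trans (map_one _).symm)
  exact Prod.ext (Subtype.ext hσ) (Subtype.ext hτ)

/-- The two blocks move disjoint sets of points and so commute; their join therefore consists of
products. -/
theorem mem_blockSubgroup {p q n : ℕ} (h : p + q = n) (υ : Equiv.Perm (Fin n)) :
    υ ∈ blockSubgroup χ h ↔ ∃ στ, (χ.blockHom h στ : Equiv.Perm (Fin n)) = υ := by
  let f := (shiftPerm (k := 0) (p := p) (n := n) (by omega)).comp (χ.W p).subtype
  let g := (shiftPerm (k := p) (p := q) (n := n) (by omega)).comp (χ.W q).subtype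
  have comm : ∀ σ τ, Commute (f σ) (g τ) := fun σ τ =>
    shiftPerm_commute _ _ (by omega) σ.1 τ.1
  have e : blockSubgroup χ h = (f.noncommCoprod g comm).range := by
    rw [MonoidHom.noncommCoprod_range, MonoidHom.range_comp, MonoidHom.range_comp,
      Subgroup.range_subtype, Subgroup.range_subtype]
    rfl
  rw [e]
  rfl

open Classical in
/-- The lexicographically minimal representatives are a transversal of the left classes of
`W_p × ω ^ p (W_q)`. -/
theorem sum_eq_card_smul_sum_minReps {M : Type*} [AddCommMonoid M] [Module K M] {p q n : ℕ}
    (h : p + q = n) (F : χ.W n → M) (hF : ∀ ρ στ, F (ρ * χ.blockHom h στ) = F ρ) :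
    ∑ ρ, F ρ = ((Nat.card (χ.W p) : K) * Nat.card (χ.W q)) • ∑ ρ ∈ minReps χ h, F ρ := by
  have h1 : ∑ ρ, F ρ = ∑ x ∈ minReps χ h ×ˢ (Finset.univ : Finset (χ.W p × χ.W q)), F x.1 := by
    symm
    refine Finset.sum_bij (fun x _ => x.1 * χ.blockHom h x.2) (fun _ _ => Finset.mem_univ _)
      ?_ ?_ fun x _ => (hF _ _).symm
    · rintro ⟨ρ, υ⟩ h1 ⟨ρ', υ'⟩ h2 e
      simp only [Finset.mem_product, Finset.mem_univ, and_true, minReps, Finset.mem_filter,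
        true_and] at h1 h2
      dsimp only at e
      have e1 : ρ * χ.blockHom h (υ * υ'⁻¹) = ρ' := by
        rw [map_mul, ← mul_assoc, e, mul_assoc, ← map_mul, mul_inv_cancel, map_one, mul_one]
      have e2 : ρ' * χ.blockHom h (υ * υ'⁻¹)⁻¹ = ρ := by
        rw [← e1, mul_assoc, ← map_mul, mul_inv_cancel, map_one, mul_one]
      -- Two minimal representatives of one coset are each at most the other, and the lexicographic
      -- order is antisymmetric.
      have l1 := h1 _ ((mem_blockSubgroup χ h _).2 ⟨υ * υ'⁻¹, rfl⟩)
      have l2 := h2 _ ((mem_blockSubgroup χ h _).2 ⟨(υ * υ'⁻¹)⁻¹, rfl⟩)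
      rw [← Subgroup.coe_mul, e1] at l1
      rw [← Subgroup.coe_mul, e2] at l2
      have hρ : ρ = ρ' := Subtype.ext (DFunLike.coe_injective (toLex_inj.1 (le_antisymm l1 l2)))
      subst hρ
      exact Prod.ext rfl (χ.blockHom_injective h (mul_left_cancel e))
    · intro ρ _
      -- A coset is finite, so it has a lexicographically least word.
      obtain ⟨υ, -, hυ⟩ := Finset.exists_min_image Finset.univ
        (fun υ => toLex (⇑((ρ * χ.blockHom h υ : χ.W n) : Equiv.Perm (Fin n))))
        ⟨1, Finset.mem_univ _⟩
      refine ⟨(ρ * χ.blockHom h υ, υ⁻¹), ?_, ?_⟩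
      · simp only [Finset.mem_product, Finset.mem_univ, and_true, minReps, Finset.mem_filter,
          true_and]
        intro τ hτ
        obtain ⟨υ', rfl⟩ := (mem_blockSubgroup χ h τ).1 hτ
        have := hυ (υ * υ') (Finset.mem_univ _)
        rwa [map_mul, ← mul_assoc, Subgroup.coe_mul (χ.W n) _ (χ.blockHom h υ')] at this
      · dsimp only
        rw [mul_assoc, ← map_mul, mul_inv_cancel, map_one, mul_one]
  rw [h1, Finset.sum_product]
  simp only [Finset.sum_const, Finset.card_univ, ← Nat.card_eq_fintype_card,
    Finset.smul_sum]
  refine Finset.sum_congr rfl fun ρ _ => ?_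
  rw [Nat.card_prod, ← Nat.cast_mul, Nat.cast_smul_eq_nsmul]

open Classical in
/-- The `χ`-symmetrization `∑_{ρ ∈ W_n} χ(ρ) F(x_{ρ(1)}, …, x_{ρ(n)})` of a function `F`. -/
noncomputable def symSum {M E : Type*} [AddCommMonoid M] [Module K M] {n : ℕ}
    (F : (Fin n → E) → M) (x : Fin n → E) : M :=
  ∑ ρ : χ.W n, (χ.char n ρ : K) • F (x ∘ (ρ : Equiv.Perm (Fin n)))

section SymSum

variable {M N E : Type*} [AddCommMonoid M] [Module K M] [AddCommMonoid N] [Module K N] {n : ℕ}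

/-- Left translation by `τ` gives the factor `χ(τ)⁻¹`, which is `χ(τ)` since the character squares
to one. This is the transformation rule of `χ`-vectors, so symmetrizations of linear maps descend to
`[χ]^n(E)`. -/
theorem symSum_comp_arg (F : (Fin n → E) → M) (x : Fin n → E) (τ : χ.W n) :
    symSum χ F (x ∘ (τ : Equiv.Perm (Fin n))) = (χ.char n τ : K) • symSum χ F x := by
  classical
  rw [symSum, symSum, Finset.smul_sum]
  refine Fintype.sum_equiv (Equiv.mulLeft τ) _ _ fun ρ => ?_
  rw [smul_smul, Equiv.coe_mulLeft, map_mul, Units.val_mul, ← mul_assoc, χ.char_val_mul_self,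
    one_mul]
  rfl

/-- The counterpart by right translation, used to absorb permutations applied inside the summand. -/
theorem symSum_comp_val (F : (Fin n → E) → M) (x : Fin n → E) (τ : χ.W n) :
    symSum χ (fun y => F (y ∘ (τ : Equiv.Perm (Fin n)))) x = (χ.char n τ : K) • symSum χ F x := by
  classical
  rw [symSum, symSum, Finset.smul_sum]
  refine Fintype.sum_equiv (Equiv.mulRight τ) _ _ fun ρ => ?_
  rw [smul_smul, Equiv.coe_mulRight, map_mul, Units.val_mul, mul_left_comm, χ.char_val_mul_self,
    mul_one]
  rfl

theorem symSum_congr {F G : (Fin n → E) → M} (h : ∀ y, F y = G y) (x : Fin n → E) :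
    symSum χ F x = symSum χ G x := by
  rw [funext h]

theorem map_symSum (L : M →ₗ[K] N) (F : (Fin n → E) → M) (x : Fin n → E) :
    L (symSum χ F x) = symSum χ (fun y => L (F y)) x := by
  simp [symSum]

theorem symSum_smul (c : K) (F : (Fin n → E) → M) (x : Fin n → E) :
    symSum χ (fun y => c • F y) x = c • symSum χ F x := by
  simp only [symSum, Finset.smul_sum, smul_comm c]

theorem symSum_sum {ι : Type*} (s : Finset ι) (F : ι → (Fin n → E) → M) (x : Fin n → E) :
    symSum χ (fun y => ∑ i ∈ s, F i y) x = ∑ i ∈ s, symSum χ (F i) x := by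
  simp only [symSum, Finset.smul_sum]
  exact Finset.sum_comm

theorem symSum_eq_card_smul (F : (Fin n → E) → M)
    (hF : ∀ (y : Fin n → E) (τ : χ.W n),
      F (y ∘ (τ : Equiv.Perm (Fin n))) = (χ.char n τ : K) • F y) (x : Fin n → E) :
    symSum χ F x = (Nat.card (χ.W n) : K) • F x := by
  classical
  simp only [symSum, hF, smul_smul, χ.char_val_mul_self, one_smul, Finset.sum_const,
    Finset.card_univ, ← Nat.card_eq_fintype_card, Nat.cast_smul_eq_nsmul]

open Classical in
/-- Symmetrizing again over a block does not change a symmetrization, up to the order of the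
group. -/
theorem symSum_sum_block {k p : ℕ} (h : k + p ≤ n) (F : (Fin n → E) → M) (x : Fin n → E) :
    symSum χ (fun y => ∑ τ : χ.W p, (χ.char p τ : K) • F (y ∘ shiftPerm h τ)) x =
      (Nat.card (χ.W p) : K) • symSum χ F x := by
  rw [symSum_sum]
  have e : ∀ τ : χ.W p, symSum χ (fun y => (χ.char p τ : K) • F (y ∘ shiftPerm h τ)) x =
      symSum χ F x := fun τ => by
    rw [symSum_smul]
    have := symSum_comp_val χ F x (χ.shiftHom h τ)
    rw [χ.coe_shiftHom] at this
    rw [this, χ.char_shiftHom, smul_smul, χ.char_val_mul_self, one_smul]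
  simp only [e, Finset.sum_const, Finset.card_univ, ← Nat.card_eq_fintype_card,
    Nat.cast_smul_eq_nsmul]

end SymSum

section Weight

variable [Algebra ℚ K]

/-- The scalar `1 / |W_n|`. -/
noncomputable def weight (n : ℕ) : K := algebraMap ℚ K (Nat.card (χ.W n) : ℚ)⁻¹

theorem weight_mul_card (n : ℕ) : weight χ n * (Nat.card (χ.W n) : K) = 1 := by
  have h : (Nat.card (χ.W n) : ℚ) ≠ 0 := Nat.cast_ne_zero.2 Nat.card_pos.ne'
  rw [weight, ← map_natCast (algebraMap ℚ K), ← map_mul, inv_mul_cancel₀ h, map_one]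

theorem weight_zero : weight χ 0 = 1 := by
  have := weight_mul_card χ 0
  rwa [Nat.card_unique, Nat.cast_one, mul_one] at this

end Weight

end Characters

/-! ### Consecutive pieces of a tuple as decomposable vectors -/

section Piece

variable {E : Type*} [AddCommGroup E] [Module K E]

/-- The decomposable `χ`-vector of the `p` entries of `x` that follow the first `k` ones, and zero
if there are fewer than `p` of them. -/
noncomputable def piece {n : ℕ} (k p : ℕ) (x : Fin n → E) : SemiSymAlg χ E :=
  if h : k + p ≤ n then chiVec χ (x ∘ shiftEmb h) else 0

variable {χ}

theorem piece_eq {n k p : ℕ} (h : k + p ≤ n) (x : Fin n → E) :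
    piece χ k p x = chiVec χ (x ∘ shiftEmb h) := dif_pos h

theorem piece_self {n : ℕ} (x : Fin n → E) : piece χ 0 n x = chiVec χ x := by
  rw [piece_eq (by omega)]
  congr 1
  funext i
  exact congrArg x (Fin.ext (by simp))

theorem piece_comp_shiftPerm {n k p : ℕ} (h : k + p ≤ n) (x : Fin n → E) (σ : χ.W p) :
    piece χ k p (x ∘ shiftPerm h σ) = (χ.char p σ : K) • piece χ k p x := by
  rw [piece_eq h, piece_eq h, ← chiVec_comp_perm]
  congr 1
  funext i
  exact congrArg x (shiftPerm_apply h _ i)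

theorem piece_comp_shiftPerm_of_disjoint {n k p j q : ℕ} (h : k + p ≤ n)
    (hd : j + q ≤ k ∨ k + p ≤ j) (x : Fin n → E) (σ : Equiv.Perm (Fin p)) :
    piece χ j q (x ∘ shiftPerm h σ) = piece χ j q x := by
  by_cases h' : j + q ≤ n
  · rw [piece_eq h', piece_eq h']
    congr 1
    funext i
    exact congrArg x (shiftPerm_apply_of_disjoint h h' hd σ i)
  · rw [piece, piece, dif_neg h', dif_neg h']

theorem piece_piece {n k m : ℕ} (h : k + m ≤ n) {j p : ℕ} (hj : j + p ≤ m) (x : Fin n → E) :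
    piece χ j p (x ∘ shiftEmb h) = piece χ (k + j) p x := by
  rw [piece_eq hj, piece_eq (by omega)]
  congr 1
  funext i
  exact congrArg x (Fin.ext (by simp; omega))

variable (χ)

theorem hom_ext {N : Type*} [AddCommMonoid N] [Module K N] {f g : SemiSymAlg χ E →ₗ[K] N}
    (h : ∀ (n : ℕ) (x : Fin n → E), f (chiVec χ x) = g (chiVec χ x)) : f = g := by
  refine DirectSum.linearMap_ext K fun n => ?_
  refine LinearMap.ext fun z => ?_
  obtain ⟨t, rfl⟩ := (relSub χ E n).mkQ_surjective z
  suffices e : (f ∘ₗ DirectSum.lof K ℕ (Power χ E) n) ∘ₗ (relSub χ E n).mkQ =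
      (g ∘ₗ DirectSum.lof K ℕ (Power χ E) n) ∘ₗ (relSub χ E n).mkQ from LinearMap.congr_fun e t
  exact PiTensorProduct.ext (MultilinearMap.ext fun x => h n x)

end Piece

/-! ### The comultiplication and its coassociativity -/

section Comul

variable {E : Type*} [AddCommGroup E] [Module K E]

/-- The canonical map `T^n(E) → [χ](E)`. -/
noncomputable def toAlg (n : ℕ) : ⨂[K]^n E →ₗ[K] SemiSymAlg χ E :=
  DirectSum.lof K ℕ (Power χ E) n ∘ₗ (relSub χ E n).mkQ

/-- The map `x_1 ⊗ … ⊗ x_n ↦ (x_1 χ … χ x_p) ⊗ (x_{p+1} χ … χ x_n)`. -/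
noncomputable def splitMap {p q n : ℕ} (h : p + q = n) :
    ⨂[K]^n E →ₗ[K] SemiSymAlg χ E ⊗[K] SemiSymAlg χ E :=
  TensorProduct.map (toAlg χ p) (toAlg χ q) ∘ₗ
    (TensorPower.mulEquiv (R := K) (M := E) (n := p) (m := q)).symm.toLinearMap ∘ₗ
    (TensorPower.cast K E h.symm).toLinearMap

theorem splitMap_tprod {p q n : ℕ} (h : p + q = n) (x : Fin n → E) :
    splitMap χ h (PiTensorProduct.tprod K x) = piece χ 0 p x ⊗ₜ[K] piece χ p q x := by
  subst h
  have e : (PiTensorProduct.tprod K x : ⨂[K]^(p + q) E) =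
      TensorPower.mulEquiv (PiTensorProduct.tprod K (fun i => x (Fin.castAdd q i)) ⊗ₜ[K]
        PiTensorProduct.tprod K (fun i => x (Fin.natAdd p i))) := by
    refine Eq.trans ?_ (TensorPower.tprod_mul_tprod K _ _).symm
    rw [Fin.append_castAdd_natAdd]
  rw [splitMap, LinearMap.comp_apply, LinearMap.comp_apply, LinearEquiv.coe_coe,
    TensorPower.cast_refl, LinearEquiv.refl_toLinearMap, LinearMap.id_apply, e,
    LinearEquiv.symm_apply_apply, TensorProduct.map_tmul,
    piece_eq (by omega), piece_eq le_rfl]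
  refine congrArg₂ (fun y z => chiVec χ y ⊗ₜ[K] chiVec χ z) (funext fun i => ?_) rfl
  exact congrArg x (Fin.ext (by simp))

open Classical in
/-- The symmetrization of a linear map on `T^n(E)` by the action of `W_n`. -/
noncomputable def symMap {M : Type*} [AddCommMonoid M] [Module K M] {n : ℕ}
    (L : ⨂[K]^n E →ₗ[K] M) : ⨂[K]^n E →ₗ[K] M :=
  ∑ ρ : χ.W n, (χ.char n ρ : K) •
    L ∘ₗ (PiTensorProduct.reindex K (fun _ => E) (ρ : Equiv.Perm (Fin n))⁻¹).toLinearMap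

theorem symMap_tprod {M : Type*} [AddCommMonoid M] [Module K M] {n : ℕ}
    (L : ⨂[K]^n E →ₗ[K] M) (x : Fin n → E) :
    symMap χ L (PiTensorProduct.tprod K x) =
      symSum χ (fun y => L (PiTensorProduct.tprod K y)) x := by
  simp only [symMap, symSum, LinearMap.sum_apply, LinearMap.smul_apply, LinearMap.comp_apply,
    LinearEquiv.coe_coe]
  refine Finset.sum_congr rfl fun ρ _ => ?_
  congr 2
  exact PiTensorProduct.reindex_tprod _ _

/-- A symmetrized linear map vanishes on the defining relations of `[χ]^n(E)`. -/
theorem relSub_le_ker_symMap {M : Type*} [AddCommMonoid M] [Module K M] {n : ℕ}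
    (L : ⨂[K]^n E →ₗ[K] M) : relSub χ E n ≤ LinearMap.ker (symMap χ L) := by
  -- Negation on `M` comes from the scalar `-1`.
  let _ := Module.addCommMonoidToAddCommGroup K (M := M)
  refine Submodule.span_le.2 ?_
  rintro w ⟨σ, z, rfl⟩
  rw [SetLike.mem_coe, LinearMap.mem_ker, map_sub, map_smul, sub_eq_zero]
  suffices h : (((χ.char n σ)⁻¹ : Kˣ) : K) • symMap χ L = symMap χ L ∘ₗ
      (PiTensorProduct.reindex K (fun _ => E) (σ : Equiv.Perm (Fin n))).toLinearMap from
    LinearMap.congr_fun h z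
  refine PiTensorProduct.ext (MultilinearMap.ext fun x => ?_)
  simp only [LinearMap.compMultilinearMap_apply, LinearMap.smul_apply, LinearMap.comp_apply,
    LinearEquiv.coe_coe]
  -- Reindexing by `σ` precomposes with `σ⁻¹`, whose character is the scalar `χ(σ)⁻¹` of the
  -- relation.
  rw [PiTensorProduct.reindex_tprod, symMap_tprod, symMap_tprod, ← map_inv, ← symSum_comp_arg]
  rfl

/-- The map on `[χ]^n(E)` induced by a linear map on `T^n(E)` that vanishes on the relations. -/
noncomputable def powerLift {M : Type*} [AddCommMonoid M] [Module K M] {n : ℕ}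
    (L : ⨂[K]^n E →ₗ[K] M) (h : relSub χ E n ≤ LinearMap.ker L) : Power χ E n →ₗ[K] M :=
  letI := Module.addCommMonoidToAddCommGroup K (M := M)
  (relSub χ E n).liftQ L h

/-- The map on `[χ]^n(E)` induced by the symmetrization of a linear map on `T^n(E)`. -/
noncomputable def symLift {M : Type*} [AddCommMonoid M] [Module K M] {n : ℕ}
    (L : ⨂[K]^n E →ₗ[K] M) : Power χ E n →ₗ[K] M :=
  powerLift χ (symMap χ L) (relSub_le_ker_symMap χ L)

variable [Algebra ℚ K]

/-- The component `[χ]^n(E) → ⨁_{p+q=n} [χ]^p(E) ⊗ [χ]^q(E)` of the comultiplication. -/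
noncomputable def comulPower (n : ℕ) :
    Power χ E n →ₗ[K] SemiSymAlg χ E ⊗[K] SemiSymAlg χ E :=
  ∑ s : Finset.HasAntidiagonal.antidiagonal n, (weight χ s.1.1 * weight χ s.1.2) •
    symLift χ (splitMap (E := E) χ (Finset.HasAntidiagonal.mem_antidiagonal.1 s.2))

variable (E) in
/-- The comultiplication `c_E` of `[χ](E)`. -/
noncomputable def comulMap : SemiSymAlg χ E →ₗ[K] SemiSymAlg χ E ⊗[K] SemiSymAlg χ E :=
  DirectSum.toModule K ℕ _ (comulPower χ)

theorem comulMap_chiVec {n : ℕ} (x : Fin n → E) :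
    comulMap χ E (chiVec χ x) = ∑ s ∈ Finset.HasAntidiagonal.antidiagonal n,
      (weight χ s.1 * weight χ s.2) •
        symSum χ (fun y => piece χ 0 s.1 y ⊗ₜ[K] piece χ s.1 s.2 y) x := by
  rw [comulMap, chiVec, DirectSum.toModule_lof, comulPower, LinearMap.sum_apply,
    ← Finset.sum_coe_sort (Finset.HasAntidiagonal.antidiagonal n)]
  refine Finset.sum_congr rfl fun s _ => ?_
  rw [LinearMap.smul_apply]
  congr 1
  refine (symMap_tprod χ _ x).trans (symSum_congr χ (fun y => ?_) x)
  exact splitMap_tprod χ _ y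

/-- Multiplying `ρ` by a block element `(σ, τ)` multiplies both `χ(ρ)` and the tensor by `χ(σ)
χ(τ)`. The square of this is one, so the summand is constant on left cosets, and the weights cancel
the coset size. -/
theorem comulMap_chiVec_eq_coproduct {n : ℕ} (x : Fin n → E) :
    comulMap χ E (chiVec χ x) = coproduct χ x := by
  classical
  rw [comulMap_chiVec, coproduct, ← Finset.sum_coe_sort (Finset.HasAntidiagonal.antidiagonal n)]
  refine Finset.sum_congr rfl fun s _ => ?_
  obtain ⟨⟨p, q⟩, hs⟩ := s
  have h : p + q = n := Finset.HasAntidiagonal.mem_antidiagonal.1 hs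
  dsimp only
  rw [symSum, sum_eq_card_smul_sum_minReps χ h, smul_smul, mul_mul_mul_comm, weight_mul_card,
    weight_mul_card, one_mul, one_smul]
  · refine Finset.sum_congr rfl fun ρ _ => ?_
    rw [piece_eq (by omega), piece_eq (by omega)]
    rfl
  · rintro ρ ⟨σ, τ⟩
    have e : x ∘ ((ρ * χ.blockHom h (σ, τ) : χ.W n) : Equiv.Perm (Fin n)) =
        ((x ∘ (ρ : Equiv.Perm (Fin n))) ∘ shiftPerm (k := 0) (by omega) (σ : Equiv.Perm (Fin p))) ∘
          shiftPerm (k := p) (by omega) (τ : Equiv.Perm (Fin q)) := rfl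
    rw [e, piece_comp_shiftPerm, piece_comp_shiftPerm_of_disjoint _ (by omega),
      piece_comp_shiftPerm, piece_comp_shiftPerm_of_disjoint _ (by omega), map_mul,
      χ.char_blockHom, TensorProduct.smul_tmul_smul, smul_smul]
    congr 1
    simp only [Units.val_mul]
    rw [mul_assoc, mul_mul_mul_comm, χ.char_val_mul_self, χ.char_val_mul_self]
    ring

open Classical in
-- The inner symmetrization is expressed by block permutations of the whole tuple, the form that
-- `symSum_sum_block` absorbs.
theorem comulMap_piece {n k m : ℕ} (h : k + m ≤ n) (x : Fin n → E) :
    comulMap χ E (piece χ k m x) = ∑ t ∈ Finset.HasAntidiagonal.antidiagonal m,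
      (weight χ t.1 * weight χ t.2) • ∑ τ : χ.W m, (χ.char m τ : K) •
        (piece χ k t.1 (x ∘ shiftPerm h τ) ⊗ₜ[K] piece χ (k + t.1) t.2 (x ∘ shiftPerm h τ)) := by
  rw [piece_eq h, comulMap_chiVec]
  refine Finset.sum_congr rfl fun t ht => ?_
  have ht := Finset.HasAntidiagonal.mem_antidiagonal.1 ht
  rw [symSum]
  congr 1
  refine Finset.sum_congr rfl fun τ _ => ?_
  have e : (x ∘ shiftEmb h) ∘ (τ : Equiv.Perm (Fin m)) = (x ∘ shiftPerm h τ) ∘ shiftEmb h := by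
    funext i
    exact congrArg x (shiftPerm_apply h _ i).symm
  rw [e, piece_piece h (by omega), piece_piece h (by omega), add_zero]

theorem sum_antidiagonal_antidiagonal {M : Type*} [AddCommMonoid M] (n : ℕ)
    (F : ℕ → ℕ → ℕ → M) :
    ∑ s ∈ Finset.HasAntidiagonal.antidiagonal n,
        ∑ t ∈ Finset.HasAntidiagonal.antidiagonal s.1, F t.1 t.2 s.2 =
      ∑ s ∈ Finset.HasAntidiagonal.antidiagonal n,
        ∑ t ∈ Finset.HasAntidiagonal.antidiagonal s.2, F s.1 t.1 t.2 := by
  rw [Finset.sum_sigma', Finset.sum_sigma']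
  refine Finset.sum_bij' (fun x _ => ⟨(x.2.1, x.2.2 + x.1.2), (x.2.2, x.1.2)⟩)
    (fun x _ => ⟨(x.1.1 + x.2.1, x.2.2), (x.1.1, x.2.1)⟩) ?_ ?_ ?_ ?_ ?_
  all_goals
    rintro ⟨⟨a, b⟩, c, d⟩ h
    simp only [Finset.mem_sigma, Finset.HasAntidiagonal.mem_antidiagonal] at h
    obtain ⟨rfl, rfl⟩ := h
    simp [add_assoc]

theorem comulMap_coassoc :
    TensorProduct.assoc K (SemiSymAlg χ E) (SemiSymAlg χ E) (SemiSymAlg χ E) ∘ₗ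
        (comulMap χ E).rTensor (SemiSymAlg χ E) ∘ₗ comulMap χ E =
      (comulMap χ E).lTensor (SemiSymAlg χ E) ∘ₗ comulMap χ E := by
  classical
  refine hom_ext χ fun n x => ?_
  -- The symmetrized three-fold splitting, normalized by the orders of three groups; both iterated
  -- coproducts are sums of these.
  let T : ℕ → ℕ → ℕ → SemiSymAlg χ E ⊗[K] (SemiSymAlg χ E ⊗[K] SemiSymAlg χ E) :=
    fun a b c => (weight χ a * weight χ b * weight χ c) • symSum χ (fun y =>
      piece χ 0 a y ⊗ₜ[K] (piece χ a b y ⊗ₜ[K] piece χ (a + b) c y)) x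
  have hl : (TensorProduct.assoc K (SemiSymAlg χ E) (SemiSymAlg χ E) (SemiSymAlg χ E) ∘ₗ
      (comulMap χ E).rTensor (SemiSymAlg χ E) ∘ₗ comulMap χ E) (chiVec χ x) =
      ∑ s ∈ Finset.HasAntidiagonal.antidiagonal n,
        ∑ t ∈ Finset.HasAntidiagonal.antidiagonal s.1, T t.1 t.2 s.2 := by
    rw [LinearMap.comp_apply, LinearMap.comp_apply, comulMap_chiVec, map_sum, map_sum]
    refine Finset.sum_congr rfl fun s hs => ?_
    have hs := Finset.HasAntidiagonal.mem_antidiagonal.1 hs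
    have h0 : 0 + s.1 ≤ n := by omega
    rw [map_smul, map_smul, map_symSum, map_symSum]
    have key : ∀ y : Fin n → E, (TensorProduct.assoc K (SemiSymAlg χ E) (SemiSymAlg χ E)
        (SemiSymAlg χ E)).toLinearMap ((comulMap χ E).rTensor (SemiSymAlg χ E)
          (piece χ 0 s.1 y ⊗ₜ[K] piece χ s.1 s.2 y)) =
        ∑ t ∈ Finset.HasAntidiagonal.antidiagonal s.1, (weight χ t.1 * weight χ t.2) •
          ∑ τ : χ.W s.1, (χ.char s.1 τ : K) • (fun z : Fin n → E => piece χ 0 t.1 z ⊗ₜ[K]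
            (piece χ t.1 t.2 z ⊗ₜ[K] piece χ (t.1 + t.2) s.2 z)) (y ∘ shiftPerm h0 τ) := by
      intro y
      rw [LinearMap.rTensor_tmul, comulMap_piece χ h0, TensorProduct.sum_tmul, map_sum]
      refine Finset.sum_congr rfl fun t ht => ?_
      have ht := Finset.HasAntidiagonal.mem_antidiagonal.1 ht
      rw [← TensorProduct.smul_tmul', map_smul, TensorProduct.sum_tmul, map_sum]
      congr 1
      refine Finset.sum_congr rfl fun τ _ => ?_
      dsimp only
      rw [← TensorProduct.smul_tmul', map_smul, LinearEquiv.coe_coe, TensorProduct.assoc_tmul,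
        zero_add, ht, piece_comp_shiftPerm_of_disjoint (j := s.1) _ (by omega)]
    rw [symSum_congr χ key, symSum_sum, Finset.smul_sum]
    refine Finset.sum_congr rfl fun t _ => ?_
    rw [symSum_smul]
    refine (congrArg _ (congrArg _ (symSum_sum_block χ h0 (fun z => piece χ 0 t.1 z ⊗ₜ[K]
      (piece χ t.1 t.2 z ⊗ₜ[K] piece χ (t.1 + t.2) s.2 z)) x))).trans ?_
    rw [smul_smul, smul_smul]
    refine congrArg (· • symSum χ _ x) ?_
    -- Absorbing the inner sum over `W_{s.1}` yields its order, which cancels the weight from the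
    -- first splitting.
    linear_combination (weight χ s.2 * weight χ t.1 * weight χ t.2) * weight_mul_card χ s.1
  have hr : ((comulMap χ E).lTensor (SemiSymAlg χ E) ∘ₗ comulMap χ E) (chiVec χ x) =
      ∑ s ∈ Finset.HasAntidiagonal.antidiagonal n,
        ∑ t ∈ Finset.HasAntidiagonal.antidiagonal s.2, T s.1 t.1 t.2 := by
    rw [LinearMap.comp_apply, comulMap_chiVec, map_sum]
    refine Finset.sum_congr rfl fun s hs => ?_
    have hs := Finset.HasAntidiagonal.mem_antidiagonal.1 hs
    have h0 : s.1 + s.2 ≤ n := by omega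
    rw [map_smul, map_symSum]
    have key : ∀ y : Fin n → E, (comulMap χ E).lTensor (SemiSymAlg χ E)
          (piece χ 0 s.1 y ⊗ₜ[K] piece χ s.1 s.2 y) =
        ∑ t ∈ Finset.HasAntidiagonal.antidiagonal s.2, (weight χ t.1 * weight χ t.2) •
          ∑ τ : χ.W s.2, (χ.char s.2 τ : K) • (fun z : Fin n → E => piece χ 0 s.1 z ⊗ₜ[K]
            (piece χ s.1 t.1 z ⊗ₜ[K] piece χ (s.1 + t.1) t.2 z)) (y ∘ shiftPerm h0 τ) := by
      intro y
      rw [LinearMap.lTensor_tmul, comulMap_piece χ h0, TensorProduct.tmul_sum]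
      refine Finset.sum_congr rfl fun t ht => ?_
      rw [TensorProduct.tmul_smul, TensorProduct.tmul_sum]
      congr 1
      refine Finset.sum_congr rfl fun τ _ => ?_
      dsimp only
      rw [TensorProduct.tmul_smul, piece_comp_shiftPerm_of_disjoint (j := 0) _ (by omega)]
    rw [symSum_congr χ key, symSum_sum, Finset.smul_sum]
    refine Finset.sum_congr rfl fun t _ => ?_
    rw [symSum_smul]
    refine (congrArg _ (congrArg _ (symSum_sum_block χ h0 (fun z => piece χ 0 s.1 z ⊗ₜ[K]
      (piece χ s.1 t.1 z ⊗ₜ[K] piece χ (s.1 + t.1) t.2 z)) x))).trans ?_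
    rw [smul_smul, smul_smul]
    refine congrArg (· • symSum χ _ x) ?_
    linear_combination (weight χ s.1 * weight χ t.1 * weight χ t.2) * weight_mul_card χ s.2
  rw [hl, hr]
  exact sum_antidiagonal_antidiagonal n T

end Comul

variable {E : Type*} [AddCommGroup E] [Module K E]

/-! ### The counit and the grading of the coproduct -/

section Counit

theorem counitForm_chiVec_zero (x : Fin 0 → E) : counitForm χ E (chiVec χ x) = 1 := by
  rw [counitForm, LinearMap.comp_apply, chiVec, DirectSum.component.lof_self]
  change TensorPower.algebraMap₀.symm (PiTensorProduct.tprod K x) = 1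
  rw [LinearEquiv.symm_apply_eq, TensorPower.algebraMap₀_one, TensorPower.gOne_def,
    Subsingleton.elim x]

theorem counitForm_chiVec_of_ne {n : ℕ} (hn : n ≠ 0) (x : Fin n → E) :
    counitForm χ E (chiVec χ x) = 0 := by
  rw [counitForm, LinearMap.comp_apply, chiVec, DirectSum.component.of, dif_neg hn, map_zero]

theorem counitForm_piece_zero {n k : ℕ} (h : k ≤ n) (x : Fin n → E) :
    counitForm χ E (piece χ k 0 x) = 1 := by
  rw [piece_eq (by omega), counitForm_chiVec_zero]

theorem counitForm_piece_of_ne {n k p : ℕ} (hp : p ≠ 0) (x : Fin n → E) :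
    counitForm χ E (piece χ k p x) = 0 := by
  rw [piece]
  split_ifs
  · exact counitForm_chiVec_of_ne χ hp _
  · exact map_zero _

variable [Algebra ℚ K]

/-- Only the splitting `(0, n)` survives. Its symmetrization is `|W_n|` times the vector itself,
which the weight cancels. -/
theorem counitForm_rTensor_comp_comulMap :
    (counitForm χ E).rTensor (SemiSymAlg χ E) ∘ₗ comulMap χ E =
      TensorProduct.mk K K (SemiSymAlg χ E) 1 := by
  refine hom_ext χ fun n x => ?_
  rw [LinearMap.comp_apply, comulMap_chiVec, map_sum, Finset.sum_eq_single (0, n)]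
  · rw [map_smul, map_symSum, symSum_congr χ (G := fun y =>
      TensorProduct.mk K K (SemiSymAlg χ E) 1 (piece χ 0 n y)), ← map_symSum,
      symSum_eq_card_smul, piece_self, ← map_smul, smul_smul, weight_zero, one_mul,
      weight_mul_card, one_smul]
    · intro y τ
      rw [piece_self, piece_self, chiVec_comp_perm]
    · intro y
      rw [LinearMap.rTensor_tmul, counitForm_piece_zero χ (Nat.zero_le n), TensorProduct.mk_apply]
  · intro s hs hne
    have hs := Finset.HasAntidiagonal.mem_antidiagonal.1 hs
    have h1 : s.1 ≠ 0 := fun h => hne (Prod.ext h (by dsimp only; omega))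
    rw [map_smul, map_symSum, symSum_congr χ (G := fun _ => 0)]
    · simp [symSum]
    · intro y
      rw [LinearMap.rTensor_tmul, counitForm_piece_of_ne χ h1, TensorProduct.zero_tmul]
  · intro h
    exact absurd (Finset.HasAntidiagonal.mem_antidiagonal.2 (zero_add n)) h

theorem counitForm_lTensor_comp_comulMap :
    (counitForm χ E).lTensor (SemiSymAlg χ E) ∘ₗ comulMap χ E =
      (TensorProduct.mk K (SemiSymAlg χ E) K).flip 1 := by
  refine hom_ext χ fun n x => ?_
  rw [LinearMap.comp_apply, comulMap_chiVec, map_sum, Finset.sum_eq_single (n, 0)]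
  · rw [map_smul, map_symSum, symSum_congr χ (G := fun y =>
      (TensorProduct.mk K (SemiSymAlg χ E) K).flip 1 (piece χ 0 n y)), ← map_symSum,
      symSum_eq_card_smul, piece_self, ← map_smul, smul_smul, weight_zero, mul_one,
      weight_mul_card, one_smul]
    · intro y τ
      rw [piece_self, piece_self, chiVec_comp_perm]
    · intro y
      rw [LinearMap.lTensor_tmul, counitForm_piece_zero χ le_rfl, LinearMap.flip_apply,
        TensorProduct.mk_apply]
  · intro s hs hne
    have hs := Finset.HasAntidiagonal.mem_antidiagonal.1 hs
    have h1 : s.2 ≠ 0 := fun h => hne (Prod.ext (by dsimp only; omega) h)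
    rw [map_smul, map_symSum, symSum_congr χ (G := fun _ => 0)]
    · simp [symSum]
    · intro y
      rw [LinearMap.lTensor_tmul, counitForm_piece_of_ne χ h1, TensorProduct.tmul_zero]
  · intro h
    exact absurd (Finset.HasAntidiagonal.mem_antidiagonal.2 (add_zero n)) h

variable (E) in
/-- The coalgebra structure of `[χ](E)`. -/
noncomputable abbrev coalgebra : Coalgebra K (SemiSymAlg χ E) where
  comul := comulMap χ E
  counit := counitForm χ E
  coassoc := comulMap_coassoc χ
  rTensor_counit_comp_comul := counitForm_rTensor_comp_comulMap χ
  lTensor_counit_comp_comul := counitForm_lTensor_comp_comulMap χ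

theorem comulMap_lof_mem_tensorDegree (n : ℕ) (z : Power χ E n) :
    comulMap χ E (DirectSum.lof K ℕ (Power χ E) n z) ∈ tensorDegree χ E n := by
  obtain ⟨t, rfl⟩ := (relSub χ E n).mkQ_surjective z
  induction t using PiTensorProduct.induction_on with
  | smul_tprod r x =>
    rw [map_smul, map_smul, map_smul]
    refine Submodule.smul_mem _ _ ?_
    change comulMap χ E (chiVec χ x) ∈ _
    rw [comulMap_chiVec]
    refine Submodule.sum_mem _ fun s hs => Submodule.smul_mem _ _ (Submodule.sum_mem _ fun ρ _ =>
      Submodule.smul_mem _ _ ?_)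
    have h := Finset.HasAntidiagonal.mem_antidiagonal.1 hs
    refine Submodule.mem_iSup_of_mem ⟨s, hs⟩ ?_
    dsimp only
    rw [piece_eq (by omega), piece_eq (by omega)]
    exact ⟨_ ⊗ₜ _, TensorProduct.map_tmul _ _ _ _⟩
  | add a b ha hb =>
    rw [map_add, map_add, map_add]
    exact Submodule.add_mem _ ha hb

end Counit

/-! ### Convolution on the graded dual -/

section Convolution

theorem mem_dualDegree {d : ℕ} {φ : WithConv (SemiSymAlg χ E →ₗ[K] K)} :
    φ ∈ dualDegree χ E d ↔
      ∀ (n : ℕ) (x : Fin n → E), n ≠ d → φ.ofConv (chiVec χ x) = 0 := by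
  constructor
  · rintro ⟨ψ, rfl⟩ n x hn
    change ψ (DirectSum.component K ℕ (Power χ E) d (chiVec χ x)) = 0
    rw [chiVec, DirectSum.component.of, dif_neg hn, map_zero]
  · intro h
    refine ⟨φ.ofConv ∘ₗ DirectSum.lof K ℕ (Power χ E) d, WithConv.ofConv_injective ?_⟩
    refine hom_ext χ fun n x => ?_
    change φ.ofConv (DirectSum.lof K ℕ (Power χ E) d
      (DirectSum.component K ℕ (Power χ E) d (chiVec χ x))) = _
    by_cases hn : n = d
    · subst hn
      rw [chiVec, DirectSum.component.lof_self]
    · rw [h n x hn, chiVec, DirectSum.component.of, dif_neg hn, map_zero, map_zero]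

theorem apply_piece_eq_zero {d p n k : ℕ} {φ : WithConv (SemiSymAlg χ E →ₗ[K] K)}
    (hφ : φ ∈ dualDegree χ E d) (hp : p ≠ d) (x : Fin n → E) :
    φ.ofConv (piece χ k p x) = 0 := by
  rw [piece]
  split_ifs
  · exact (mem_dualDegree χ).1 hφ _ _ hp
  · exact map_zero _

variable [Algebra ℚ K]

attribute [local instance] coalgebra

theorem convMul_chiVec (φ ψ : WithConv (SemiSymAlg χ E →ₗ[K] K)) {n : ℕ} (x : Fin n → E) :
    (φ * ψ).ofConv (chiVec χ x) = ∑ s ∈ Finset.HasAntidiagonal.antidiagonal n,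
      (weight χ s.1 * weight χ s.2) •
        symSum χ (fun y => φ.ofConv (piece χ 0 s.1 y) * ψ.ofConv (piece χ s.1 s.2 y)) x := by
  have e : (φ * ψ).ofConv (chiVec χ x) = (LinearMap.mul' K K ∘ₗ
      TensorProduct.map φ.ofConv ψ.ofConv) (comulMap χ E (chiVec χ x)) := rfl
  rw [e, comulMap_chiVec, map_sum]
  refine Finset.sum_congr rfl fun s _ => ?_
  rw [map_smul, map_symSum]
  rfl

theorem convOne_chiVec {n : ℕ} (x : Fin n → E) :
    (1 : WithConv (SemiSymAlg χ E →ₗ[K] K)).ofConv (chiVec χ x) =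
      counitForm χ E (chiVec χ x) := rfl

theorem dualDegree_gradedMonoid : SetLike.GradedMonoid (dualDegree χ E) where
  one_mem := (mem_dualDegree χ).2 fun _ x hn => counitForm_chiVec_of_ne χ hn x
  mul_mem := fun p q φ ψ hφ hψ => (mem_dualDegree χ).2 fun n x hn => by
    rw [convMul_chiVec]
    refine Finset.sum_eq_zero fun s hs => ?_
    have h := Finset.HasAntidiagonal.mem_antidiagonal.1 hs
    rw [symSum_congr χ (G := fun _ => 0)]
    · simp [symSum]
    · intro y
      by_cases h1 : s.1 = p
      · rw [apply_piece_eq_zero χ hψ (by omega), mul_zero]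
      · rw [apply_piece_eq_zero χ hφ h1, zero_mul]

end Convolution

/-! ### The pairing in a fixed degree -/

section Pairing

theorem power_ext {N : Type*} [AddCommMonoid N] [Module K N] {n : ℕ} {f g : Power χ E n →ₗ[K] N}
    (h : ∀ x : Fin n → E, f ((relSub χ E n).mkQ (PiTensorProduct.tprod K x)) =
      g ((relSub χ E n).mkQ (PiTensorProduct.tprod K x))) : f = g := by
  refine LinearMap.ext fun z => ?_
  obtain ⟨t, rfl⟩ := (relSub χ E n).mkQ_surjective z
  suffices e : f ∘ₗ (relSub χ E n).mkQ = g ∘ₗ (relSub χ E n).mkQ from LinearMap.congr_fun e t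
  exact PiTensorProduct.ext (MultilinearMap.ext h)

theorem mkQ_reindex {n : ℕ} (σ : χ.W n) (z : ⨂[K]^n E) :
    (relSub χ E n).mkQ (PiTensorProduct.reindex K (fun _ => E) (σ : Equiv.Perm (Fin n)) z) =
      (χ.char n σ : K) • (relSub χ E n).mkQ z := by
  rw [← map_smul, eq_comm]
  refine (Submodule.Quotient.eq (relSub χ E n)).2 (Submodule.subset_span ⟨σ, z, ?_⟩)
  rw [χ.char_inv]

theorem symLift_mkQ_tprod {M : Type*} [AddCommMonoid M] [Module K M] {n : ℕ}
    (L : ⨂[K]^n E →ₗ[K] M) (x : Fin n → E) :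
    symLift χ L ((relSub χ E n).mkQ (PiTensorProduct.tprod K x)) =
      symSum χ (fun y => L (PiTensorProduct.tprod K y)) x :=
  symMap_tprod χ L x

variable {F : Type*} [AddCommGroup F] [Module K F] (θ : F ≃ₗ[K] Module.Dual K E)

/-- The form on `T^n(F) × T^n(E)` induced by an identification of `F` with the dual of `E`. -/
noncomputable def tensorForm (n : ℕ) : ⨂[K]^n F →ₗ[K] ⨂[K]^n E →ₗ[K] K :=
  PiTensorProduct.dualDistrib ∘ₗ PiTensorProduct.map (fun _ => θ.toLinearMap)

theorem tensorForm_tprod {n : ℕ} (f : Fin n → F) (x : Fin n → E) :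
    tensorForm θ n (PiTensorProduct.tprod K f) (PiTensorProduct.tprod K x) =
      ∏ j, θ (f j) (x j) := by
  rw [tensorForm, LinearMap.comp_apply, PiTensorProduct.map_tprod]
  exact PiTensorProduct.dualDistrib_apply _ _

/-- For finite free `E` the tensor power of the dual is the dual of the tensor power. -/
theorem tensorForm_bijective [Module.Free K E] [Module.Finite K E] (n : ℕ) :
    Function.Bijective (tensorForm θ n) :=
  ((PiTensorProduct.congr (fun _ : Fin n => θ)).trans
    (PiTensorProduct.dualDistribEquiv (R := K) (M := fun _ : Fin n => E))).bijective

theorem tensorForm_reindex {n : ℕ} (z : ⨂[K]^n F) (t : ⨂[K]^n E) (ρ : Equiv.Perm (Fin n)) :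
    tensorForm θ n (PiTensorProduct.reindex K (fun _ => F) ρ z) t =
      tensorForm θ n z (PiTensorProduct.reindex K (fun _ => E) ρ⁻¹ t) := by
  suffices h : tensorForm θ n ∘ₗ (PiTensorProduct.reindex K (fun _ => F) ρ).toLinearMap =
      (LinearMap.lcomp K K (PiTensorProduct.reindex K (fun _ => E) ρ⁻¹).toLinearMap) ∘ₗ
        tensorForm θ n from LinearMap.congr_fun (LinearMap.congr_fun h z) t
  refine PiTensorProduct.ext (MultilinearMap.ext fun f =>
    PiTensorProduct.ext (MultilinearMap.ext fun x => ?_))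
  simp only [LinearMap.compMultilinearMap_apply, LinearMap.comp_apply, LinearEquiv.coe_coe,
    LinearMap.lcomp_apply]
  rw [PiTensorProduct.reindex_tprod, PiTensorProduct.reindex_tprod, tensorForm_tprod,
    tensorForm_tprod]
  exact Fintype.prod_equiv ρ⁻¹ _ _ fun j => by simp [← Equiv.Perm.inv_def]

/-- The form `T^n(F) → ([χ]^n(E))^*` that sends `f_1 ⊗ … ⊗ f_n` to
`x_1 χ … χ x_n ↦ ∑_ρ χ(ρ) ∏_j f_j(x_{ρ(j)})`. -/
noncomputable def tensorPairing (n : ℕ) : ⨂[K]^n F →ₗ[K] Power χ E n →ₗ[K] K where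
  toFun z := symLift χ (tensorForm θ n z)
  map_add' z w := power_ext χ fun x => by
    rw [LinearMap.add_apply, symLift_mkQ_tprod, symLift_mkQ_tprod, symLift_mkQ_tprod]
    simp [symSum, mul_add, Finset.sum_add_distrib]
  map_smul' c z := power_ext χ fun x => by
    rw [LinearMap.smul_apply, symLift_mkQ_tprod, symLift_mkQ_tprod, RingHom.id_apply,
      ← symSum_smul]
    simp [symSum]

theorem tensorPairing_tprod {n : ℕ} (f : Fin n → F) (x : Fin n → E) :
    tensorPairing χ θ n (PiTensorProduct.tprod K f)
        ((relSub χ E n).mkQ (PiTensorProduct.tprod K x)) =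
      symSum χ (fun y => ∏ j, θ (f j) (y j)) x :=
  (symLift_mkQ_tprod χ _ x).trans (symSum_congr χ (fun y => tensorForm_tprod θ f y) x)

/-- Permuting the functionals amounts to permuting the arguments inside the symmetrized product,
which costs a factor `χ(σ) = χ(σ)⁻¹`. -/
theorem relSub_le_ker_tensorPairing (n : ℕ) :
    relSub χ F n ≤ LinearMap.ker (tensorPairing χ θ n) := by
  refine Submodule.span_le.2 ?_
  rintro w ⟨σ, z, rfl⟩
  rw [SetLike.mem_coe, LinearMap.mem_ker, map_sub, map_smul, sub_eq_zero]
  suffices h : (((χ.char n σ)⁻¹ : Kˣ) : K) • tensorPairing χ θ n = tensorPairing χ θ n ∘ₗ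
      (PiTensorProduct.reindex K (fun _ => F) (σ : Equiv.Perm (Fin n))).toLinearMap from
    LinearMap.congr_fun h z
  refine PiTensorProduct.ext (MultilinearMap.ext fun f => power_ext χ fun x => ?_)
  simp only [LinearMap.compMultilinearMap_apply, LinearMap.smul_apply, LinearMap.comp_apply,
    LinearEquiv.coe_coe]
  rw [PiTensorProduct.reindex_tprod, tensorPairing_tprod, tensorPairing_tprod, χ.char_inv,
    ← symSum_comp_val]
  refine symSum_congr χ (fun y => ?_) x
  exact Fintype.prod_equiv (σ : Equiv.Perm (Fin n)) _ _ fun j => by simp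

/-- The pairing `[χ]^n(F) → ([χ]^n(E))^*`. -/
noncomputable def powerPairing (n : ℕ) : Power χ F n →ₗ[K] Power χ E n →ₗ[K] K :=
  powerLift χ (tensorPairing χ θ n) (relSub_le_ker_tensorPairing χ θ n)

theorem powerPairing_tprod {n : ℕ} (f : Fin n → F) (x : Fin n → E) :
    powerPairing χ θ n ((relSub χ F n).mkQ (PiTensorProduct.tprod K f))
        ((relSub χ E n).mkQ (PiTensorProduct.tprod K x)) =
      symSum χ (fun y => ∏ j, θ (f j) (y j)) x :=
  tensorPairing_tprod χ θ f x

open Classical in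
theorem powerPairing_mkQ {n : ℕ} (z : ⨂[K]^n F) (t : ⨂[K]^n E) :
    powerPairing χ θ n ((relSub χ F n).mkQ z) ((relSub χ E n).mkQ t) =
      ∑ ρ : χ.W n, (χ.char n ρ : K) * tensorForm θ n z
        (PiTensorProduct.reindex K (fun _ => E) ((ρ⁻¹ : χ.W n) : Equiv.Perm (Fin n)) t) := by
  change symMap χ (tensorForm θ n z) t = _
  simp [symMap]

variable [Algebra ℚ K] [Module.Free K E] [Module.Finite K E]

/-- Pull `φ` back to `T^n(E)` and represent it by a tensor `z`. Since `φ` already respects the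
relations, symmetrizing gives `|W_n|` copies of it, whence the preimage `z / |W_n|`. -/
theorem powerPairing_surjective (n : ℕ) : Function.Surjective (powerPairing χ θ n) := by
  classical
  intro φ
  obtain ⟨z, hz⟩ := (tensorForm_bijective θ n).2 (φ ∘ₗ (relSub χ E n).mkQ)
  refine ⟨weight χ n • (relSub χ F n).mkQ z, LinearMap.ext fun t => ?_⟩
  obtain ⟨t, rfl⟩ := (relSub χ E n).mkQ_surjective t
  rw [map_smul, LinearMap.smul_apply, powerPairing_mkQ, hz]
  simp only [LinearMap.comp_apply, mkQ_reindex, map_smul, map_inv, χ.char_inv, smul_eq_mul,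
    ← mul_assoc, χ.char_val_mul_self, one_mul, Finset.sum_const, Finset.card_univ,
    ← Nat.card_eq_fintype_card, nsmul_eq_mul, weight_mul_card]

/-- If the class of `z` pairs to zero, nondegeneracy on tensor powers forces `∑ χ(ρ) ρ z = 0`. In
the quotient this sum is `|W_n|` times the class of `z`, and `|W_n|` is invertible. -/
theorem powerPairing_injective (n : ℕ) : Function.Injective (powerPairing χ θ n) := by
  classical
  rw [injective_iff_map_eq_zero]
  intro z hz
  obtain ⟨z, rfl⟩ := (relSub χ F n).mkQ_surjective z
  have h : ∑ ρ : χ.W n, (χ.char n ρ : K) • PiTensorProduct.reindex K (fun _ => F)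
      (ρ : Equiv.Perm (Fin n)) z = 0 := by
    refine (tensorForm_bijective θ n).1 (LinearMap.ext fun t => ?_)
    have := LinearMap.congr_fun hz ((relSub χ E n).mkQ t)
    rw [powerPairing_mkQ] at this
    rw [map_sum, LinearMap.sum_apply, map_zero]
    refine (Finset.sum_congr rfl fun ρ _ => ?_).trans this
    rw [map_smul, LinearMap.smul_apply, tensorForm_reindex, smul_eq_mul, Subgroup.coe_inv]
  have h2 := congrArg (relSub χ F n).mkQ h
  simp only [map_sum, map_smul, mkQ_reindex, smul_smul, χ.char_val_mul_self, one_smul,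
    Finset.sum_const, Finset.card_univ, ← Nat.card_eq_fintype_card, map_zero] at h2
  rw [← Nat.cast_smul_eq_nsmul K] at h2
  have h3 := congrArg (weight χ n • ·) h2
  simpa only [smul_smul, weight_mul_card, one_smul, smul_zero] using h3

end Pairing

/-! ### The algebra isomorphism onto the graded dual -/

section GradedDual

variable {F : Type*} [AddCommGroup F] [Module K F] (θ : F ≃ₗ[K] Module.Dual K E)

/-- The pairing `[χ](F) → ([χ](E))^*`. -/
noncomputable def algPairing : SemiSymAlg χ F →ₗ[K] WithConv (SemiSymAlg χ E →ₗ[K] K) :=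
  DirectSum.toModule K ℕ _ fun d =>
    (WithConv.linearEquiv K (SemiSymAlg χ E →ₗ[K] K)).symm.toLinearMap ∘ₗ
      LinearMap.lcomp K K (DirectSum.component K ℕ (Power χ E) d) ∘ₗ powerPairing χ θ d

theorem algPairing_lof (d : ℕ) (z : Power χ F d) (a : SemiSymAlg χ E) :
    (algPairing χ θ (DirectSum.lof K ℕ (Power χ F) d z)).ofConv a =
      powerPairing χ θ d z (DirectSum.component K ℕ (Power χ E) d a) := by
  rw [algPairing, DirectSum.toModule_lof]
  rfl

theorem algPairing_lof_mem (d : ℕ) (z : Power χ F d) :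
    algPairing χ θ (DirectSum.lof K ℕ (Power χ F) d z) ∈ dualDegree χ E d :=
  (mem_dualDegree χ).2 fun n x hn => by
    rw [algPairing_lof, chiVec, DirectSum.component.of, dif_neg hn, map_zero]

theorem algPairing_apply_lof (a : SemiSymAlg χ F) (d : ℕ) (t : Power χ E d) :
    (algPairing χ θ a).ofConv (DirectSum.lof K ℕ (Power χ E) d t) =
      powerPairing χ θ d (DirectSum.component K ℕ (Power χ F) d a) t := by
  suffices h : (LinearMap.applyₗ (DirectSum.lof K ℕ (Power χ E) d t)) ∘ₗ
      (WithConv.linearEquiv K (SemiSymAlg χ E →ₗ[K] K)).toLinearMap ∘ₗ algPairing χ θ =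
      (LinearMap.applyₗ t) ∘ₗ powerPairing χ θ d ∘ₗ DirectSum.component K ℕ (Power χ F) d from
    LinearMap.congr_fun h a
  refine DirectSum.linearMap_ext K fun e => LinearMap.ext fun z => ?_
  change (algPairing χ θ (DirectSum.lof K ℕ (Power χ F) e z)).ofConv _ =
    powerPairing χ θ d (DirectSum.component K ℕ (Power χ F) d
      (DirectSum.lof K ℕ (Power χ F) e z)) t
  rw [algPairing_lof]
  by_cases h : e = d
  · subst h
    rw [DirectSum.component.lof_self, DirectSum.component.lof_self]
  · rw [DirectSum.component.of, dif_neg (Ne.symm h), DirectSum.component.of, dif_neg h, map_zero,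
      map_zero, LinearMap.zero_apply]

theorem algPairing_chiVec {n : ℕ} (f : Fin n → F) (x : Fin n → E) :
    (algPairing χ θ (chiVec χ f)).ofConv (chiVec χ x) =
      symSum χ (fun y => ∏ j, θ (f j) (y j)) x := by
  rw [chiVec, algPairing_lof, chiVec, DirectSum.component.lof_self, powerPairing_tprod]

theorem algPairing_chiVec_of_ne {r s : ℕ} (h : r ≠ s) (f : Fin s → F) (x : Fin r → E) :
    (algPairing χ θ (chiVec χ f)).ofConv (chiVec χ x) = 0 :=
  (mem_dualDegree χ).1 (algPairing_lof_mem χ θ s _) r x h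

/-- Substitute `ρ⁻¹` for `ρ`; the character does not change. -/
theorem symSum_prod_eq_schurFunction {n : ℕ} (f : Fin n → Module.Dual K E) (x : Fin n → E) :
    symSum χ (fun y => ∏ j, f j (y j)) x =
      schurFunction χ (Matrix.of fun i j => f j (x i)) := by
  classical
  rw [symSum, schurFunction]
  refine Fintype.sum_equiv (Equiv.inv _) _ _ fun ρ => ?_
  simp [χ.char_inv]

open Classical in
theorem algPairing_piece {n k p : ℕ} (h : k + p ≤ n) (f : Fin p → F) (y : Fin n → E) :
    (algPairing χ θ (chiVec χ f)).ofConv (piece χ k p y) = ∑ τ : χ.W p, (χ.char p τ : K) *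
      ∏ j, θ (f j) ((y ∘ shiftPerm h τ) (shiftEmb h j)) := by
  rw [piece_eq h, algPairing_chiVec, symSum]
  refine Finset.sum_congr rfl fun τ _ => ?_
  simp [shiftPerm_apply]

open Classical in
/-- Symmetrizing over two disjoint blocks the factors of a product does not change the
symmetrization of the product, up to the orders of the groups. -/
theorem symSum_mul_block {E : Type*} {n k p j q : ℕ} (h : k + p ≤ n) (h' : j + q ≤ n)
    (hd : j + q ≤ k ∨ k + p ≤ j) (P Q : (Fin n → E) → K)
    (hP : ∀ (y : Fin n → E) (υ : χ.W q), P (y ∘ shiftPerm h' υ) = P y)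
    (hQ : ∀ (y : Fin n → E) (τ : χ.W p), Q (y ∘ shiftPerm h τ) = Q y) (x : Fin n → E) :
    symSum χ (fun y => (∑ τ : χ.W p, (χ.char p τ : K) * P (y ∘ shiftPerm h τ)) *
      ∑ υ : χ.W q, (χ.char q υ : K) * Q (y ∘ shiftPerm h' υ)) x =
      ((Nat.card (χ.W p) : K) * Nat.card (χ.W q)) • symSum χ (fun y => P y * Q y) x := by
  let G : (Fin n → E) → K := fun z => P z * ∑ υ : χ.W q, (χ.char q υ : K) * Q (z ∘ shiftPerm h' υ)
  let H : (Fin n → E) → K := fun z => P z * Q z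
  have key : ∀ y : Fin n → E, ((∑ τ : χ.W p, (χ.char p τ : K) * P (y ∘ shiftPerm h τ)) *
      ∑ υ : χ.W q, (χ.char q υ : K) * Q (y ∘ shiftPerm h' υ)) =
      ∑ τ : χ.W p, (χ.char p τ : K) • G (y ∘ shiftPerm h τ) := by
    intro y
    rw [Finset.sum_mul]
    refine Finset.sum_congr rfl fun τ _ => ?_
    rw [smul_eq_mul, mul_assoc]
    refine congrArg (fun c => (χ.char p τ : K) * (P (y ∘ shiftPerm h τ) * c))
      (Finset.sum_congr rfl fun υ _ => ?_)
    have e : (y ∘ shiftPerm h (τ : Equiv.Perm (Fin p))) ∘ shiftPerm h' υ =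
        (y ∘ shiftPerm h' υ) ∘ shiftPerm h (τ : Equiv.Perm (Fin p)) := by
      have := (shiftPerm_commute h h' hd (τ : Equiv.Perm (Fin p)) (υ : Equiv.Perm (Fin q))).eq
      funext i
      exact congrArg y (congrArg (fun π : Equiv.Perm (Fin n) => π i) this)
    rw [e, hQ]
  have key2 : ∀ y : Fin n → E,
      G y = ∑ υ : χ.W q, (χ.char q υ : K) • H (y ∘ shiftPerm h' υ) := by
    intro y
    simp only [G, H, Finset.mul_sum, hP, smul_eq_mul]
    exact Finset.sum_congr rfl fun υ _ => mul_left_comm _ _ _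
  rw [symSum_congr χ key, symSum_sum_block, symSum_congr χ key2, symSum_sum_block, smul_smul]

section Algebra

variable [Algebra ℚ K]

attribute [local instance] coalgebra

theorem algPairing_one : algPairing χ θ 1 = 1 := by
  have h : (1 : SemiSymAlg χ F) = chiVec χ (Fin.elim0 : Fin 0 → F) := rfl
  rw [h]
  refine WithConv.ofConv_injective (hom_ext χ fun n x => ?_)
  rw [convOne_chiVec]
  by_cases hn : n = 0
  · subst hn
    rw [counitForm_chiVec_zero, algPairing_chiVec, symSum_eq_card_smul, Nat.card_unique]
    · simp
    · intro y τ
      simp [Subsingleton.elim τ 1]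
  · rw [algPairing_chiVec_of_ne χ θ hn, counitForm_chiVec_of_ne χ hn]

/-- In degree `p + q` only the splitting `(p, q)` contributes. The two pairings symmetrize separate
blocks, so the outer sum absorbs them, the weights cancel `|W_p| |W_q|`, and the symmetrized product
over the concatenated functionals remains. -/
theorem algPairing_chiVec_mul {p q : ℕ} (f : Fin p → F) (g : Fin q → F) :
    algPairing χ θ (chiVec χ f * chiVec χ g) =
      algPairing χ θ (chiVec χ f) * algPairing χ θ (chiVec χ g) := by
  classical
  have hf : algPairing χ θ (chiVec χ f) ∈ dualDegree χ E p := algPairing_lof_mem χ θ p _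
  have hg : algPairing χ θ (chiVec χ g) ∈ dualDegree χ E q := algPairing_lof_mem χ θ q _
  rw [chiVec_mul_chiVec]
  refine WithConv.ofConv_injective (hom_ext χ fun n x => ?_)
  by_cases hn : n = p + q
  · subst hn
    have h0 : 0 + p ≤ p + q := by omega
    have h1 : p + q ≤ p + q := le_rfl
    let P : (Fin (p + q) → E) → K := fun y => ∏ j, θ (f j) (y (shiftEmb h0 j))
    let Q : (Fin (p + q) → E) → K := fun y => ∏ j, θ (g j) (y (shiftEmb h1 j))
    have hPQ : ∀ y : Fin (p + q) → E, (∏ j, θ (Fin.append f g j) (y j)) = P y * Q y := by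
      intro y
      rw [Fin.prod_univ_add]
      congr 1
      · refine Finset.prod_congr rfl fun j _ => ?_
        rw [Fin.append_left]
        exact congrArg (fun i => θ (f j) (y i)) (Fin.ext (by simp))
      · refine Finset.prod_congr rfl fun j _ => ?_
        rw [Fin.append_right]
        rfl
    have hP : ∀ (y : Fin (p + q) → E) (υ : χ.W q), P (y ∘ shiftPerm h1 υ) = P y := by
      intro y υ
      refine Finset.prod_congr rfl fun j _ => ?_
      rw [Function.comp_apply, shiftPerm_apply_of_disjoint _ _ (by omega)]
    have hQ : ∀ (y : Fin (p + q) → E) (τ : χ.W p), Q (y ∘ shiftPerm h0 τ) = Q y := by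
      intro y τ
      refine Finset.prod_congr rfl fun j _ => ?_
      rw [Function.comp_apply, shiftPerm_apply_of_disjoint _ _ (by omega)]
    have key : ∀ y : Fin (p + q) → E,
        (algPairing χ θ (chiVec χ f)).ofConv (piece χ 0 p y) *
          (algPairing χ θ (chiVec χ g)).ofConv (piece χ p q y) =
        (∑ τ : χ.W p, (χ.char p τ : K) * P (y ∘ shiftPerm h0 τ)) *
          ∑ υ : χ.W q, (χ.char q υ : K) * Q (y ∘ shiftPerm h1 υ) := fun y => by
      rw [algPairing_piece χ θ h0, algPairing_piece χ θ h1]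
    rw [algPairing_chiVec, symSum_congr χ hPQ, convMul_chiVec, Finset.sum_eq_single (p, q)]
    · rw [symSum_congr χ key, symSum_mul_block χ h0 h1 (by omega) P Q hP hQ, smul_smul,
        mul_mul_mul_comm, weight_mul_card, weight_mul_card, one_mul, one_smul]
    · intro s hs hne
      have h := Finset.HasAntidiagonal.mem_antidiagonal.1 hs
      rw [symSum_congr χ (G := fun _ => 0)]
      · simp [symSum]
      · intro y
        by_cases h1 : s.1 = p
        · have h2 : s.2 ≠ q := fun h2 => hne (Prod.ext h1 h2)
          rw [apply_piece_eq_zero χ hg h2, mul_zero]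
        · rw [apply_piece_eq_zero χ hf h1, zero_mul]
    · intro h
      exact (h (Finset.HasAntidiagonal.mem_antidiagonal.2 rfl)).elim
  · rw [algPairing_chiVec_of_ne χ θ hn]
    exact ((mem_dualDegree χ).1 ((dualDegree_gradedMonoid χ).mul_mem hf hg) n x hn).symm

theorem algPairing_mul (a b : SemiSymAlg χ F) :
    algPairing χ θ (a * b) = algPairing χ θ a * algPairing χ θ b := by
  suffices h : (LinearMap.mul K (SemiSymAlg χ F)).compr₂ (algPairing χ θ) =
      (LinearMap.mul K (WithConv (SemiSymAlg χ E →ₗ[K] K))).compl₁₂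
        (algPairing χ θ) (algPairing χ θ) from LinearMap.congr_fun₂ h a b
  exact hom_ext χ fun p f => hom_ext χ fun q g => algPairing_chiVec_mul χ θ f g

/-- The homomorphism of algebras `[χ](F) → ([χ](E))^*`. -/
noncomputable def algPairingHom :
    SemiSymAlg χ F →ₐ[K] WithConv (SemiSymAlg χ E →ₗ[K] K) :=
  AlgHom.ofLinearMap (algPairing χ θ) (algPairing_one χ θ) (algPairing_mul χ θ)

variable [Module.Free K E] [Module.Finite K E]

/-- Testing on elements of `[χ]^d(E)` isolates the component of degree `d`, where the pairing is
injective. -/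
theorem algPairing_injective : Function.Injective (algPairing χ θ) := by
  rw [injective_iff_map_eq_zero]
  intro a ha
  refine DFinsupp.ext fun d => powerPairing_injective χ θ d (LinearMap.ext fun t => ?_)
  have := algPairing_apply_lof χ θ a d t
  rw [ha] at this
  rw [DFinsupp.zero_apply, map_zero]
  exact this.symm

theorem range_algPairing : LinearMap.range (algPairing χ θ) = ⨆ d, dualDegree χ E d := by
  refine le_antisymm ?_ (iSup_le fun d => ?_)
  · rintro _ ⟨a, rfl⟩
    induction a using DirectSum.induction_on with
    | zero => rw [map_zero]; exact zero_mem _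
    | of d z => exact Submodule.mem_iSup_of_mem d (algPairing_lof_mem χ θ d z)
    | add a b ha hb => rw [map_add]; exact add_mem ha hb
  · rintro _ ⟨ψ, rfl⟩
    obtain ⟨z, hz⟩ := powerPairing_surjective χ θ d ψ
    refine ⟨DirectSum.lof K ℕ (Power χ F) d z,
      WithConv.ofConv_injective (LinearMap.ext fun a => ?_)⟩
    rw [algPairing_lof, hz]
    rfl

end Algebra

end GradedDual

end SemiSym

/-! ### The main theorem -/

theorem mainTheorem1 {K : Type*} [CommRing K] [IsDomain K] [Algebra ℚ K]
    {E : Type*} [AddCommGroup E] [Module K E] [Module.Free K E] [Module.Finite K E]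
    (χ : SemiSym.OmegaInvariant K) :
    ∃ C : Coalgebra K (SemiSym.SemiSymAlg χ E),
      (∀ (n : ℕ) (x : Fin n → E),
        C.comul (SemiSym.chiVec χ x) = SemiSym.coproduct χ x) ∧
      C.counit = SemiSym.counitForm χ E ∧
      (∀ (n : ℕ) (z : SemiSym.Power χ E n),
        C.comul (DirectSum.lof K ℕ (SemiSym.Power χ E) n z) ∈ SemiSym.tensorDegree χ E n) ∧
      SetLike.GradedMonoid (SemiSym.dualDegree χ E) ∧
      ∃ D : Subalgebra K (WithConv (SemiSym.SemiSymAlg χ E →ₗ[K] K)),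
        Subalgebra.toSubmodule D = ⨆ d : ℕ, SemiSym.dualDegree χ E d ∧
        ∃ ι : SemiSym.SemiSymAlg χ (Module.Dual K E) ≃ₐ[K] D,
          (∀ (d : ℕ) (z : SemiSym.Power χ (Module.Dual K E) d),
            (ι (DirectSum.lof K ℕ (SemiSym.Power χ (Module.Dual K E)) d z) :
              WithConv (SemiSym.SemiSymAlg χ E →ₗ[K] K)) ∈ SemiSym.dualDegree χ E d) ∧
          ∀ (r s : ℕ) (x : Fin r → E) (f : Fin s → Module.Dual K E),
            (ι (SemiSym.chiVec χ f) : WithConv (SemiSym.SemiSymAlg χ E →ₗ[K] K)).ofConv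
                (SemiSym.chiVec χ x) =
              if h : r = s then
                SemiSym.schurFunction χ
                  (Matrix.of fun i j : Fin r => f (Fin.cast h j) (x i))
              else 0 := by
  let _ := SemiSym.coalgebra χ E
  -- The pairing was built for any module `F` identified with the dual; here `F` is the dual itself.
  let θ : Module.Dual K E ≃ₗ[K] Module.Dual K E := LinearEquiv.refl K _
  have hinj : Function.Injective (SemiSym.algPairingHom χ θ) := SemiSym.algPairing_injective χ θ
  refine ⟨SemiSym.coalgebra χ E, fun n x => SemiSym.comulMap_chiVec_eq_coproduct χ x, rfl,
    SemiSym.comulMap_lof_mem_tensorDegree χ, SemiSym.dualDegree_gradedMonoid χ,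
    (SemiSym.algPairingHom χ θ).range, SemiSym.range_algPairing χ θ,
    AlgEquiv.ofInjective _ hinj, SemiSym.algPairing_lof_mem χ θ, fun r s x f => ?_⟩
  change (SemiSym.algPairing χ θ (SemiSym.chiVec χ f)).ofConv _ = _
  split_ifs with h
  · subst h
    exact (SemiSym.algPairing_chiVec χ θ f x).trans
      (SemiSym.symSum_prod_eq_schurFunction χ f x)
  · exact SemiSym.algPairing_chiVec_of_ne χ θ h f x
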